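/- Let $N$ be a smooth $2$-manifold without boundary (Hausdorff, second countable; for instance $N=\partial M$ for an oriented $3$-manifold $M$ with boundary), endowed with a Lorentzian metric $g$ of signature $(-,+)$, an orientation represented by a nowhere-vanishing $2$-form $\omega$, and a time-orientation represented by a time-like vector field $\tau$. A null vector $v\neq 0$ in $T_pN$ is called $\nearrow$-pointing if $g(\tau,v)<0$ and $\omega(\tau,v)>0$, $\nwarrow$-pointing if $g(\tau,v)<0$ and $\omega(\tau,v)<0$, $\swarrow$-pointing if $g(\tau,v)>0$ and $\omega(\tau,v)<0$, and $\searrow$-pointing if $g(\tau,v)>0$ and $\omega(\tau,v)>0$. For $a\in\{\nearrow,\nwarrow,\swarrow,\searrow\}$ and $K\subseteq N$ let $J^{a}(K)$ be the union of $K$ and the set of all endpoints of smooth curves $[0,1]\to N$ that start in $K$ and all of whose tangent vectors are $a$-pointing null vectors. Let $\ast$ be the Hodge operator on $1$-forms, normalized by $\alpha\wedge\ast\beta=g^{-1}(\alpha,\beta)\,\mathrm{vol}_g$, and let $\Omega^{\pm}(N)=\{\alpha\in\Omega^1(N):\ast\alpha=\pm\alpha\}$. The self-dual ($+$) and anti-self-dual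 ($-$) boundary conditions are the subcomplexes $$\mathfrak{L}^{\pm}=\big(0\to\Omega^{\pm}(N)\xrightarrow{-\mathrm{d}}\Omega^2(N)\big)\subseteq\Omega^\bullet(N)[1],$$ with $\Omega^{\pm}(N)$ in degree $0$. An $a$-pointed Green's homotopy for $\mathfrak{L}^{\pm}$ is a $(-1)$-cochain $G\in[\mathfrak{L}^{\pm}_{\mathrm c},\mathfrak{L}^{\pm}]^{-1}$ of the internal hom complex (where $\mathfrak{L}^\pm_{\mathrm c}$ denotes compactly supported sections) such that $\partial G$ is the inclusion $\mathfrak{L}^{\pm}_{\mathrm c}\to\mathfrak{L}^{\pm}$ and $\mathrm{supp}(G\alpha)\subseteq J^{a}(\mathrm{supp}\,\alpha)$ for all homogeneous $\alpha\in\mathfrak{L}^{\pm}_{\mathrm c}$. A $+$-chiral (respectively $-$-chiral) flow is a smooth $\mathbb{R}$-action $\Theta:\mathbb{R}\times N\to N$ that is the global flow of a complete smooth vector field which is everywhere $\nearrow$-pointing (respectively $\nwarrow$-pointing) and null. It is proper if the map $(s,p)\mapsto(p,\Theta(s,p))$ is proper. For a proper flow $\Theta$ define $$G^{\uparrow}_{\Theta}=\int_{\mathbb{R}^{\leq0}}\Theta^{\ast},\qquad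 G^{\downarrow}_{\Theta}=-\int_{\mathbb{R}^{\geq0}}\Theta^{\ast},$$ where the integrals denote fiber integration along the projection $\mathbb{R}\times N\to N$ restricted to the indicated parameters (fiber direction in the first slot). (1) Let $\Theta_+$ be a proper $+$-chiral flow on $N$. Then $-G^{\uparrow}_{\Theta_+}$ and $-G^{\downarrow}_{\Theta_+}$ are well-defined $(-1)$-cochains in $[\Omega^\bullet_{\mathrm c}(N)[1],\Omega^\bullet(N)[1]]$; they restrict to $(-1)$-cochains $G^{\nearrow}$ and $G^{\swarrow}$ in $[\mathfrak{L}^{+}_{\mathrm c},\mathfrak{L}^{+}]$, and $G^{\nearrow}$ is a $\nearrow$-pointed and $G^{\swarrow}$ a $\swarrow$-pointed Green's homotopy for $\mathfrak{L}^{+}$. (2) Let $\Theta_-$ be a proper $-$-chiral flow on $N$. Then $-G^{\uparrow}_{\Theta_-}$ and $-G^{\downarrow}_{\Theta_-}$ are well-defined $(-1)$-cochains in $[\Omega^\bullet_{\mathrm c}(N)[1],\Omega^\bullet(N)[1]]$; they restrict to $(-1)$-cochains $G^{\nwarrow}$ and $G^{\searrow}$ in $[\mathfrak{L}^{-}_{\mathrm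 c},\mathfrak{L}^{-}]$, and $G^{\nwarrow}$ is a $\nwarrow$-pointed and $G^{\searrow}$ a $\searrow$-pointed Green's homotopy for $\mathfrak{L}^{-}$. -/

import Mathlib

open Set Manifold Bundle ContDiff Topology MeasureTheory
open CategoryTheory CochainComplex.HomComplex

noncomputable section

universe u

/-! ### Differential forms on a surface -/

section Forms

variable (N : Type u) [TopologicalSpace N] [ChartedSpace (EuclideanSpace ℝ (Fin 2)) N]

/-- A field of alternating `k`-linear forms on the tangent spaces of the surface `N`, without any
regularity. -/
abbrev RawForm (k : ℕ) : Type u :=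
  ∀ p : N, TangentSpace (𝓡 2) p [⋀^Fin k]→L[ℝ] ℝ

variable {N}

/-- The representative of a form in the chart around `c`, that is, its pullback along the inverse
of that chart. -/
def RawForm.chartRep {k : ℕ} (α : RawForm N k) (c : N) (y : EuclideanSpace ℝ (Fin 2)) :
    EuclideanSpace ℝ (Fin 2) [⋀^Fin k]→L[ℝ] ℝ :=
  (α ((extChartAt (𝓡 2) c).symm y)).compContinuousLinearMap
    (mfderiv 𝓘(ℝ, EuclideanSpace ℝ (Fin 2)) (𝓡 2) (extChartAt (𝓡 2) c).symm y)

/-- A form is smooth if all its chart representatives are. -/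
def RawForm.IsSmooth {k : ℕ} (α : RawForm N k) : Prop :=
  ∀ c : N, ContDiffOn ℝ ∞ (α.chartRep c) (extChartAt (𝓡 2) c).target

/-- The exterior derivative, computed at `p` in the chart around `p`. -/
def RawForm.extd {k : ℕ} (α : RawForm N k) : RawForm N (k + 1) := fun p =>
  (extDeriv (α.chartRep p) (extChartAt (𝓡 2) p p)).compContinuousLinearMap
    (mfderiv (𝓡 2) 𝓘(ℝ, EuclideanSpace ℝ (Fin 2)) (extChartAt (𝓡 2) p) p)

/-- The support of a form. -/
def RawForm.supp {k : ℕ} (α : RawForm N k) : Set N := closure {p | α p ≠ 0}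

lemma RawForm.chartRep_add {k : ℕ} (α β : RawForm N k) (c : N) :
    (α + β).chartRep c = α.chartRep c + β.chartRep c := rfl

lemma RawForm.chartRep_smul {k : ℕ} (a : ℝ) (α : RawForm N k) (c : N) :
    (a • α).chartRep c = a • α.chartRep c := rfl

lemma RawForm.chartRep_zero {k : ℕ} (c : N) :
    (0 : RawForm N k).chartRep c = 0 := rfl

lemma RawForm.chartRep_eventuallyEq_zero {k : ℕ} {α : RawForm N k} {c : N}
    {y : EuclideanSpace ℝ (Fin 2)} (hy : y ∈ (extChartAt (𝓡 2) c).target)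
    (h : (extChartAt (𝓡 2) c).symm y ∉ α.supp) : α.chartRep c =ᶠ[𝓝 y] 0 := by
  have hcont : ContinuousAt (extChartAt (𝓡 2) c).symm y := continuousAt_extChartAt_symm'' hy
  have hopen : (α.supp)ᶜ ∈ 𝓝 ((extChartAt (𝓡 2) c).symm y) :=
    isClosed_closure.isOpen_compl.mem_nhds h
  filter_upwards [hcont hopen] with z hz
  have h0 : α ((extChartAt (𝓡 2) c).symm z) = 0 := by
    by_contra hne
    exact hz (subset_closure hne)
  simp only [RawForm.chartRep, h0]
  rfl

/-- The exterior derivative does not enlarge supports. -/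
lemma RawForm.supp_extd_subset {k : ℕ} (α : RawForm N k) : α.extd.supp ⊆ α.supp := by
  refine closure_minimal (fun p hp => ?_) isClosed_closure
  by_contra hnot
  apply hp
  have h1 := RawForm.chartRep_eventuallyEq_zero (α := α) (c := p) (mem_extChartAt_target p)
    (by rwa [extChartAt_to_inv])
  have h2 : extDeriv (α.chartRep p) (extChartAt (𝓡 2) p p) = 0 := by
    rw [h1.extDeriv_eq]
    ext v
    simp [extDeriv, Pi.zero_def, ContinuousAlternatingMap.alternatizeUncurryFin_apply]
  simp only [RawForm.extd, h2]
  rfl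

lemma RawForm.extd_add {k : ℕ} {α β : RawForm N k} (hα : α.IsSmooth) (hβ : β.IsSmooth) :
    (α + β).extd = α.extd + β.extd := by
  funext p
  have h := fun {γ : RawForm N k} (hγ : γ.IsSmooth) => ((hγ p).contDiffAt
    ((isOpen_extChartAt_target p).mem_nhds (mem_extChartAt_target p))).differentiableAt (by simp)
  simp only [RawForm.extd, RawForm.chartRep_add, extDeriv_add (h hα) (h hβ), Pi.add_apply]
  rfl

lemma RawForm.extd_smul {k : ℕ} (a : ℝ) (α : RawForm N k) :
    (a • α).extd = a • α.extd := by
  funext p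
  simp only [RawForm.extd, RawForm.chartRep_smul, extDeriv_smul, Pi.smul_apply]
  rfl

/-- The covector underlying a `1`-form at a point. -/
def covector {p : N} (α : TangentSpace (𝓡 2) p [⋀^Fin 1]→L[ℝ] ℝ) : TangentSpace (𝓡 2) p →L[ℝ] ℝ :=
  α.toContinuousMultilinearMap.toContinuousLinearMap 0 0

lemma covector_add {p : N} (α β : TangentSpace (𝓡 2) p [⋀^Fin 1]→L[ℝ] ℝ) :
    covector (α + β) = covector α + covector β := rfl

lemma covector_smul {p : N} (a : ℝ) (α : TangentSpace (𝓡 2) p [⋀^Fin 1]→L[ℝ] ℝ) :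
    covector (a • α) = a • covector α := rfl

lemma covector_zero {p : N} :
    covector (0 : TangentSpace (𝓡 2) p [⋀^Fin 1]→L[ℝ] ℝ) = 0 := rfl

variable [IsManifold (𝓡 2) ∞ N]

/-- A form is recovered from its representative in any chart. -/
lemma RawForm.chartRep_comp_mfderiv {k : ℕ} (α : RawForm N k) (c : N) {x : N}
    (hx : x ∈ (extChartAt (𝓡 2) c).source) :
    (α.chartRep c (extChartAt (𝓡 2) c x)).compContinuousLinearMap
      (mfderiv (𝓡 2) 𝓘(ℝ, EuclideanSpace ℝ (Fin 2)) (extChartAt (𝓡 2) c) x) = α x := by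
  have hinv : (mfderiv 𝓘(ℝ, EuclideanSpace ℝ (Fin 2)) (𝓡 2) (extChartAt (𝓡 2) c).symm
        (extChartAt (𝓡 2) c x)).comp
      (mfderiv (𝓡 2) 𝓘(ℝ, EuclideanSpace ℝ (Fin 2)) (extChartAt (𝓡 2) c) x) =
      ContinuousLinearMap.id ℝ _ := by
    have := mfderivWithin_extChartAt_symm_comp_mfderiv_extChartAt' (I := 𝓡 2) hx
    simpa [mfderivWithin_univ] using this
  have hpt : ∀ (x' : N) (_ : x' = x) (w : Fin k → EuclideanSpace ℝ (Fin 2)),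
      (α x' : EuclideanSpace ℝ (Fin 2) [⋀^Fin k]→L[ℝ] ℝ) w =
        (α x : EuclideanSpace ℝ (Fin 2) [⋀^Fin k]→L[ℝ] ℝ) w := by
    rintro x' rfl w; rfl
  ext v
  refine (hpt _ ((extChartAt (𝓡 2) c).left_inv hx) _).trans ?_
  refine congrArg (α x : EuclideanSpace ℝ (Fin 2) [⋀^Fin k]→L[ℝ] ℝ) ?_
  funext i
  exact DFunLike.congr_fun hinv (v i)

lemma mfderiv_extChartAt_comp_symm (c c' : N) {y : EuclideanSpace ℝ (Fin 2)}
    (hy : y ∈ ((extChartAt (𝓡 2) c).symm ≫ extChartAt (𝓡 2) c').source) :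
    fderiv ℝ (extChartAt (𝓡 2) c' ∘ (extChartAt (𝓡 2) c).symm) y =
      (mfderiv (𝓡 2) 𝓘(ℝ, EuclideanSpace ℝ (Fin 2)) (extChartAt (𝓡 2) c')
        ((extChartAt (𝓡 2) c).symm y)).comp
        (mfderiv 𝓘(ℝ, EuclideanSpace ℝ (Fin 2)) (𝓡 2) (extChartAt (𝓡 2) c).symm y) := by
  rw [PartialEquiv.trans_source] at hy
  have hcs : MDifferentiableAt 𝓘(ℝ, EuclideanSpace ℝ (Fin 2)) (𝓡 2)
      (extChartAt (𝓡 2) c).symm y :=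
    ((contMDiffOn_extChartAt_symm (n := ∞) c).contMDiffAt
      ((isOpen_extChartAt_target c).mem_nhds hy.1)).mdifferentiableAt (by simp)
  have hc' : MDifferentiableAt (𝓡 2) 𝓘(ℝ, EuclideanSpace ℝ (Fin 2))
      (extChartAt (𝓡 2) c') ((extChartAt (𝓡 2) c).symm y) :=
    (contMDiffAt_extChartAt' (n := ∞) (by
      have := hy.2
      rwa [mem_preimage, extChartAt_source] at this)).mdifferentiableAt (by simp)
  rw [← mfderiv_eq_fderiv]
  exact mfderiv_comp y hc' hcs

/-- Change of charts for chart representatives. -/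
lemma RawForm.chartRep_change {k : ℕ} (α : RawForm N k) (c c' : N)
    {y : EuclideanSpace ℝ (Fin 2)}
    (hy : y ∈ ((extChartAt (𝓡 2) c).symm ≫ extChartAt (𝓡 2) c').source) :
    α.chartRep c y =
      (α.chartRep c' ((extChartAt (𝓡 2) c' ∘ (extChartAt (𝓡 2) c).symm) y)).compContinuousLinearMap
        (fderiv ℝ (extChartAt (𝓡 2) c' ∘ (extChartAt (𝓡 2) c).symm) y) := by
  rw [mfderiv_extChartAt_comp_symm c c' hy]
  rw [PartialEquiv.trans_source] at hy
  have h := RawForm.chartRep_comp_mfderiv α c' hy.2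
  rw [RawForm.chartRep, ← h]
  rfl

/-- In every chart, `RawForm.extd` is the exterior derivative of the chart representative. -/
lemma RawForm.chartRep_extd {k : ℕ} {α : RawForm N k} (hα : α.IsSmooth) (c : N)
    {y : EuclideanSpace ℝ (Fin 2)} (hy : y ∈ (extChartAt (𝓡 2) c).target) :
    α.extd.chartRep c y = extDeriv (α.chartRep c) y := by
  set x := (extChartAt (𝓡 2) c).symm y with hx
  have hyx : y ∈ ((extChartAt (𝓡 2) c).symm ≫ extChartAt (𝓡 2) x).source := by
    rw [PartialEquiv.trans_source]
    exact ⟨hy, mem_extChartAt_source x⟩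
  have hopen : IsOpen ((extChartAt (𝓡 2) c).symm ≫ extChartAt (𝓡 2) x).source := by
    rw [PartialEquiv.trans_source]
    exact (continuousOn_extChartAt_symm c).isOpen_inter_preimage
      (isOpen_extChartAt_target c) (isOpen_extChartAt_source x)
  have hf : ContDiffAt ℝ ∞ (extChartAt (𝓡 2) x ∘ (extChartAt (𝓡 2) c).symm) y :=
    (contDiffOn_ext_coord_change (n := ∞) x c).contDiffAt (hopen.mem_nhds hyx)
  have hfy : (extChartAt (𝓡 2) x ∘ (extChartAt (𝓡 2) c).symm) y = extChartAt (𝓡 2) x x := rfl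
  have hdiff : DifferentiableAt ℝ (α.chartRep x)
      ((extChartAt (𝓡 2) x ∘ (extChartAt (𝓡 2) c).symm) y) := by
    rw [hfy]
    exact ((hα x).contDiffAt ((isOpen_extChartAt_target x).mem_nhds
      (mem_extChartAt_target x))).differentiableAt (by simp)
  have heq : α.chartRep c =ᶠ[𝓝 y] fun z =>
      (α.chartRep x ((extChartAt (𝓡 2) x ∘ (extChartAt (𝓡 2) c).symm) z)).compContinuousLinearMap
        (fderiv ℝ (extChartAt (𝓡 2) x ∘ (extChartAt (𝓡 2) c).symm) z) := by
    filter_upwards [hopen.mem_nhds hyx] with z hz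
    exact RawForm.chartRep_change α c x hz
  rw [heq.extDeriv_eq, extDeriv_pullback hdiff hf (by simp; exact WithTop.coe_le_coe.2 le_top),
    mfderiv_extChartAt_comp_symm c x hyx]
  rfl

lemma RawForm.IsSmooth.extd {k : ℕ} {α : RawForm N k} (hα : α.IsSmooth) :
    α.extd.IsSmooth := by
  intro c
  have h1 : ContDiffOn ℝ ∞ (extDeriv (α.chartRep c)) (extChartAt (𝓡 2) c).target :=
    (ContinuousAlternatingMap.alternatizeUncurryFinCLM ℝ (EuclideanSpace ℝ (Fin 2)) ℝ).contDiff.comp_contDiffOn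
      ((hα c).fderiv_of_isOpen (isOpen_extChartAt_target c) (by simp))
  exact h1.congr fun y hy => RawForm.chartRep_extd hα c hy

lemma RawForm.extd_extd {k : ℕ} {α : RawForm N k} (hα : α.IsSmooth) : α.extd.extd = 0 := by
  funext p
  have hp := mem_extChartAt_target (I := 𝓡 2) p
  have hev : α.extd.chartRep p =ᶠ[𝓝 (extChartAt (𝓡 2) p p)] extDeriv (α.chartRep p) := by
    filter_upwards [(isOpen_extChartAt_target p).mem_nhds hp] with y hy
    exact RawForm.chartRep_extd hα p hy
  have h0 : extDeriv (α.extd.chartRep p) (extChartAt (𝓡 2) p p) = 0 := by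
    rw [hev.extDeriv_eq]
    exact extDeriv_extDeriv_apply
      ((hα p).contDiffAt ((isOpen_extChartAt_target p).mem_nhds hp)) (by simp; exact WithTop.coe_le_coe.2 le_top)
  simp only [RawForm.extd, h0]
  rfl

end Forms

/-! ### Complexes of differential forms -/

section Complexes

variable (N : Type u) [TopologicalSpace N] [ChartedSpace (EuclideanSpace ℝ (Fin 2)) N]

/-- A subcomplex of the de Rham complex of `N`: in every form degree a linear space of smooth forms,
stable under the exterior derivative. -/
structure DeRhamSubcomplex where
  carrier : ∀ k : ℕ, Submodule ℝ (RawForm N k)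
  smooth : ∀ {k : ℕ} {α : RawForm N k}, α ∈ carrier k → α.IsSmooth
  extd_mem : ∀ {k : ℕ} {α : RawForm N k}, α ∈ carrier k → α.extd ∈ carrier (k + 1)

/-- The space of smooth `k`-forms. -/
def smoothForms (k : ℕ) : Submodule ℝ (RawForm N k) where
  carrier := {α | α.IsSmooth}
  add_mem' := fun hα hβ c => by
    rw [RawForm.chartRep_add]
    exact (hα c).add (hβ c)
  zero_mem' := fun c => by
    rw [RawForm.chartRep_zero]
    exact contDiffOn_const
  smul_mem' := fun a α hα c => by
    rw [RawForm.chartRep_smul]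
    exact contDiffOn_const.smul (hα c)

/-- The space of `k`-forms with compact support. -/
def compactlySupportedForms (k : ℕ) : Submodule ℝ (RawForm N k) where
  carrier := {α | IsCompact α.supp}
  add_mem' := fun {α β} hα hβ => by
    refine (IsCompact.union hα hβ).of_isClosed_subset isClosed_closure ?_
    unfold RawForm.supp
    rw [← closure_union]
    refine closure_mono fun p hp => ?_
    by_contra h
    simp only [mem_union, mem_ofPred_eq, not_or, not_not] at h
    exact hp (by rw [Pi.add_apply, h.1, h.2, add_zero])
  zero_mem' := by simp [RawForm.supp]
  smul_mem' := fun a α hα => by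
    refine IsCompact.of_isClosed_subset hα isClosed_closure (closure_mono fun p hp h => ?_)
    exact hp (by rw [Pi.smul_apply, h, smul_zero])

variable {N}

/-- The subcomplex of compactly supported forms in a subcomplex. -/
def DeRhamSubcomplex.compact (A : DeRhamSubcomplex N) : DeRhamSubcomplex N where
  carrier k := A.carrier k ⊓ compactlySupportedForms N k
  smooth hα := A.smooth hα.1
  extd_mem hα := ⟨A.extd_mem hα.1,
    IsCompact.of_isClosed_subset hα.2 isClosed_closure (RawForm.supp_extd_subset _)⟩

/-- The exterior derivative as a linear map on a subcomplex. -/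
def DeRhamSubcomplex.d (A : DeRhamSubcomplex N) (k : ℕ) : A.carrier k →ₗ[ℝ] A.carrier (k + 1) where
  toFun α := ⟨α.1.extd, A.extd_mem α.2⟩
  map_add' α β := Subtype.ext (RawForm.extd_add (A.smooth α.2) (A.smooth β.2))
  map_smul' a α := Subtype.ext (RawForm.extd_smul a α.1)

/-- The degree `n` part, `n` an integer, of a subcomplex of the de Rham complex. A member is a
`k`-form for the natural number `k = n`; if `n` is negative, the space is trivial. -/
abbrev DeRhamSubcomplex.degree (A : DeRhamSubcomplex N) (n : ℤ) : Type u :=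
  ∀ k : {k : ℕ // (k : ℤ) = n}, A.carrier k

/-- The exterior derivative on the integer-graded subcomplex. -/
def DeRhamSubcomplex.dInt (A : DeRhamSubcomplex N) (n : ℤ) :
    A.degree n →ₗ[ℝ] A.degree (n + 1) where
  toFun x
    | ⟨0, _⟩ => 0
    | ⟨k + 1, h⟩ => A.d k (x ⟨k, by push_cast at h; lia⟩)
  map_add' x y := by
    funext ⟨k, h⟩
    cases k with
    | zero => exact (add_zero 0).symm
    | succ k => exact map_add (A.d k) _ _
  map_smul' a x := by
    funext ⟨k, h⟩
    cases k with
    | zero => exact (smul_zero a).symm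
    | succ k => exact map_smul (A.d k) a _

variable [IsManifold (𝓡 2) ∞ N]

variable (N) in
/-- The de Rham complex of `N`. -/
def deRham : DeRhamSubcomplex N where
  carrier := smoothForms N
  smooth hα := hα
  extd_mem hα := RawForm.IsSmooth.extd hα

/-- A subcomplex of the de Rham complex as a cochain complex, graded by form degree. -/
def DeRhamSubcomplex.toComplex (A : DeRhamSubcomplex N) : CochainComplex (ModuleCat.{u} ℝ) ℤ :=
  CochainComplex.of (fun n => ModuleCat.of ℝ (A.degree n)) (fun n => ModuleCat.ofHom (A.dInt n))
    (fun n => by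
      refine ModuleCat.hom_ext (LinearMap.ext fun x => funext fun k => ?_)
      match k with
      | ⟨0, _⟩ => rfl
      | ⟨1, _⟩ => exact map_zero (A.d 0)
      | ⟨k + 2, _⟩ => exact Subtype.ext (RawForm.extd_extd (A.smooth (Subtype.property _))))

/-- The `1`-shifted complex `A[1]`: it has the `k`-forms in degree `k - 1`, and differential `-d`. -/
abbrev DeRhamSubcomplex.shifted (A : DeRhamSubcomplex N) : CochainComplex (ModuleCat.{u} ℝ) ℤ :=
  A.toComplex⟦(1 : ℤ)⟧

/-- The `k`-form underlying an element of `A[1]` of degree `p = k - 1`. -/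
def DeRhamSubcomplex.form (A : DeRhamSubcomplex N) {p : ℤ} (x : A.shifted.X p) (k : ℕ)
    (hk : (k : ℤ) = p + 1) : RawForm N k :=
  ((show A.degree (p + 1) from x) ⟨k, hk⟩).1

/-- The support of a homogeneous element of `A[1]`. -/
def DeRhamSubcomplex.supp (A : DeRhamSubcomplex N) {p : ℤ} (x : A.shifted.X p) : Set N :=
  closure {q | ∃ (k : ℕ) (hk : (k : ℤ) = p + 1), A.form x k hk q ≠ 0}

/-- The inclusion of a subcomplex in a larger one, as a cochain map. -/
def DeRhamSubcomplex.incl {A B : DeRhamSubcomplex N} (h : ∀ k, A.carrier k ≤ B.carrier k) :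
    A.toComplex ⟶ B.toComplex :=
  CochainComplex.ofHom
    (fun n => ModuleCat.ofHom
      (LinearMap.pi fun k => (Submodule.inclusion (h k)).comp (LinearMap.proj k)))
    (fun n => by
      simp only [DeRhamSubcomplex.toComplex, CochainComplex.of_d]
      refine ModuleCat.hom_ext (LinearMap.ext fun x => funext fun k => ?_)
      match k with
      | ⟨0, _⟩ => rfl
      | ⟨k + 1, _⟩ => rfl)

/-- A Green's homotopy for `A[1]` whose supports are controlled by `J`: a `(-1)`-cochain in the
internal hom complex from the compactly supported part of `A[1]` to `A[1]` whose differential is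
the canonical inclusion. -/
structure IsGreensHomotopy (A : DeRhamSubcomplex N) (J : Set N → Set N)
    (G : Cochain A.compact.shifted A.shifted (-1)) : Prop where
  boundary : δ (-1) 0 G =
    Cochain.ofHom ((DeRhamSubcomplex.incl (A := A.compact) (B := A)
      fun _ => inf_le_left)⟦(1 : ℤ)⟧')
  supp_subset : ∀ (p q : ℤ) (h : p + -1 = q) (x : A.compact.shifted.X p),
    A.supp ((G.v p q h).hom x) ⊆ J (A.compact.supp x)

end Complexes

/-! ### Flows and fiber integration -/

section Flows

variable {N : Type u} [TopologicalSpace N] [ChartedSpace (EuclideanSpace ℝ (Fin 2)) N]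

/-- A (global, smooth) flow on `N`, that is, a smooth action of `ℝ` on `N`. -/
structure IsFlow (Θ : ℝ × N → N) : Prop where
  contMDiff : ContMDiff (𝓘(ℝ, ℝ).prod (𝓡 2)) (𝓡 2) ∞ Θ
  zero : ∀ p, Θ (0, p) = p
  add : ∀ s t p, Θ (s + t, p) = Θ (s, Θ (t, p))

/-- A flow is proper if its shear map `(s, p) ↦ (p, Θ (s, p))` is proper. -/
def IsProperFlow (Θ : ℝ × N → N) : Prop :=
  IsProperMap fun x : ℝ × N => (x.2, Θ x)

/-- The pullback of a form along `Θ : ℝ × N → N`. -/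
def flowPullback (Θ : ℝ × N → N) {k : ℕ} (α : RawForm N k) (x : ℝ × N) :
    TangentSpace (𝓘(ℝ, ℝ).prod (𝓡 2)) x [⋀^Fin k]→L[ℝ] ℝ :=
  (α (Θ x)).compContinuousLinearMap (mfderiv (𝓘(ℝ, ℝ).prod (𝓡 2)) (𝓡 2) Θ x)

/-- The fiber integral, evaluated at the vectors `v i` tangent to `N` at `p`, of the pullback of a
form along `Θ` restricted to `T × N`, along the projection `T × N → N`, where `T` is an interval.
The fiber direction is inserted in the first slot. -/
def fiberIntegral (T : Set ℝ) (Θ : ℝ × N → N) {k : ℕ} (α : RawForm N (k + 1)) (p : N)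
    (v : Fin k → TangentSpace (𝓡 2) p) : ℝ :=
  ∫ s in T, flowPullback Θ α (s, p)
    (Fin.cons (show TangentSpace (𝓘(ℝ, ℝ).prod (𝓡 2)) (s, p) from ((1 : ℝ), 0))
      fun i => (show TangentSpace (𝓘(ℝ, ℝ).prod (𝓡 2)) (s, p) from ((0 : ℝ), v i)))

/-- The forward operator `α ↦ ∫_{s ≤ 0} Θ^* α`. -/
def forwardG (Θ : ℝ × N → N) {k : ℕ} (α : RawForm N (k + 1)) (p : N)
    (v : Fin k → TangentSpace (𝓡 2) p) : ℝ :=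
  fiberIntegral (Iic 0) Θ α p v

/-- The backward operator `α ↦ - ∫_{s ≥ 0} Θ^* α`. -/
def backwardG (Θ : ℝ × N → N) {k : ℕ} (α : RawForm N (k + 1)) (p : N)
    (v : Fin k → TangentSpace (𝓡 2) p) : ℝ :=
  -fiberIntegral (Ici 0) Θ α p v

end Flows

/-! ### Oriented and time-oriented Lorentzian surfaces -/

section Lorentz

/-- The four directions `↗`, `↖`, `↙`, `↘` of null vectors on a surface. -/
inductive NullDirection
  | ne
  | nw
  | sw
  | se

variable (N : Type u) [TopologicalSpace N] [ChartedSpace (EuclideanSpace ℝ (Fin 2)) N]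
  [IsManifold (𝓡 2) ∞ N]

/-- A Lorentzian metric of signature `(-,+)` on the surface `N`, an orientation, represented by
a nowhere vanishing `2`-form, and a time orientation, represented by a time-like vector field. -/
structure LorentzStructure where
  g : ∀ p : N, TangentSpace (𝓡 2) p →L[ℝ] TangentSpace (𝓡 2) p →L[ℝ] ℝ
  g_smooth : ContMDiff (𝓡 2) ((𝓡 2).prod 𝓘(ℝ, EuclideanSpace ℝ (Fin 2) →L[ℝ]
      EuclideanSpace ℝ (Fin 2) →L[ℝ] ℝ)) ∞
    (fun p => TotalSpace.mk' (EuclideanSpace ℝ (Fin 2) →L[ℝ] EuclideanSpace ℝ (Fin 2) →L[ℝ] ℝ)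
      (E := fun p : N => TangentSpace (𝓡 2) p →L[ℝ] TangentSpace (𝓡 2) p →L[ℝ] ℝ) p (g p))
  g_symm : ∀ p u v, g p u v = g p v u
  g_signature : ∀ p, ∃ e : Fin 2 → TangentSpace (𝓡 2) p,
    g p (e 0) (e 0) = -1 ∧ g p (e 1) (e 1) = 1 ∧ g p (e 0) (e 1) = 0
  orient : RawForm N 2
  orient_smooth : orient.IsSmooth
  orient_ne_zero : ∀ p, orient p ≠ 0
  time : ∀ p : N, TangentSpace (𝓡 2) p
  time_smooth : ContMDiff (𝓡 2) (𝓡 2).tangent ∞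
    (fun p => (⟨p, time p⟩ : TangentBundle (𝓡 2) N))
  time_timelike : ∀ p, g p (time p) (time p) < 0

variable {N}

namespace LorentzStructure

variable (S : LorentzStructure N)

/-- A chosen orthonormal frame at `p`, with no condition on its orientation. -/
def frame (p : N) : Fin 2 → TangentSpace (𝓡 2) p := (S.g_signature p).choose

/-- The volume form of the metric and the orientation: the positive multiple of the orienting form
that takes the values `1` and `-1` on orthonormal frames. -/
def vol (p : N) : TangentSpace (𝓡 2) p [⋀^Fin 2]→L[ℝ] ℝ :=
  |S.orient p (S.frame p)|⁻¹ • S.orient p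

lemma g_injective (p : N) : Function.Injective (S.g p) := by
  obtain ⟨e, h00, h11, h01⟩ := S.g_signature p
  have h10 : S.g p (e 1) (e 0) = 0 := by rw [S.g_symm, h01]
  have hli : LinearIndependent ℝ e := by
    rw [Fintype.linearIndependent_iff]
    intro c hc
    rw [Fin.sum_univ_two] at hc
    have k0 : S.g p (c 0 • e 0 + c 1 • e 1) (e 0) = 0 := by rw [hc, map_zero]; rfl
    have k1 : S.g p (c 0 • e 0 + c 1 • e 1) (e 1) = 0 := by rw [hc, map_zero]; rfl
    simp [h00, h10] at k0
    simp [h11, h01] at k1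
    intro i
    fin_cases i <;> assumption
  have hfr : Fintype.card (Fin 2) = Module.finrank ℝ (TangentSpace (𝓡 2) p) := by
    change _ = Module.finrank ℝ (EuclideanSpace ℝ (Fin 2))
    simp
  let b := basisOfLinearIndependentOfCardEqFinrank hli hfr
  rw [injective_iff_map_eq_zero]
  intro u hu
  have hb : ∀ i, b i = e i := fun i => by simp [b]
  have hsum := b.sum_repr u
  rw [Fin.sum_univ_two, hb, hb] at hsum
  have h0 : S.g p u (e 0) = 0 := by rw [hu]; rfl
  have h1 : S.g p u (e 1) = 0 := by rw [hu]; rfl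
  rw [← hsum] at h0 h1
  simp [h00, h10] at h0
  simp [h11, h01] at h1
  rw [← hsum, h0, h1]
  simp

lemma g_bijective (p : N) : Function.Bijective (S.g p).toLinearMap := by
  have : FiniteDimensional ℝ (TangentSpace (𝓡 2) p) :=
    inferInstanceAs (FiniteDimensional ℝ (EuclideanSpace ℝ (Fin 2)))
  have : T2Space (TangentSpace (𝓡 2) p) := inferInstanceAs (T2Space (EuclideanSpace ℝ (Fin 2)))
  have hfr : Module.finrank ℝ (TangentSpace (𝓡 2) p) =
      Module.finrank ℝ (TangentSpace (𝓡 2) p →L[ℝ] ℝ) := by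
    rw [← (LinearMap.toContinuousLinearMap (𝕜 := ℝ) (E := TangentSpace (𝓡 2) p)
      (F' := ℝ)).finrank_eq]
    exact (Subspace.dual_finrank_eq (K := ℝ) (V := TangentSpace (𝓡 2) p)).symm
  have : FiniteDimensional ℝ (TangentSpace (𝓡 2) p →L[ℝ] ℝ) :=
    Module.Finite.equiv (LinearMap.toContinuousLinearMap (𝕜 := ℝ) (E := TangentSpace (𝓡 2) p)
      (F' := ℝ))
  exact ⟨S.g_injective p,
    (LinearMap.injective_iff_surjective_of_finrank_eq_finrank hfr).1 (S.g_injective p)⟩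

/-- The musical isomorphism `v ↦ g (v, ·)`. -/
def flat (p : N) :
    TangentSpace (𝓡 2) p ≃ₗ[ℝ] (TangentSpace (𝓡 2) p →L[ℝ] ℝ) :=
  LinearEquiv.ofBijective (S.g p).toLinearMap (S.g_bijective p)

/-- The Hodge operator on covectors: `* β` is the contraction of the volume form with the vector
dual to `β`, so that `α ∧ * β = g⁻¹ (α, β) vol`. -/
def hodgeStar (p : N) (β : TangentSpace (𝓡 2) p →L[ℝ] ℝ) : TangentSpace (𝓡 2) p →L[ℝ] ℝ :=
  (S.vol p).toContinuousMultilinearMap.toContinuousLinearMap ![(S.flat p).symm β, 0] 1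

lemma hodgeStar_apply (p : N) (β : TangentSpace (𝓡 2) p →L[ℝ] ℝ) (v : TangentSpace (𝓡 2) p) :
    S.hodgeStar p β v = S.vol p ![(S.flat p).symm β, v] := by
  change S.vol p (Function.update ![(S.flat p).symm β, 0] 1 v) = _
  congr 1
  ext i : 1
  fin_cases i <;> rfl

lemma hodgeStar_add (p : N) (β γ : TangentSpace (𝓡 2) p →L[ℝ] ℝ) :
    S.hodgeStar p (β + γ) = S.hodgeStar p β + S.hodgeStar p γ := by
  ext v
  simp only [_root_.add_apply, hodgeStar_apply, map_add]
  exact (S.vol p).toMultilinearMap.cons_add ![v] _ _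

lemma hodgeStar_smul (p : N) (a : ℝ) (β : TangentSpace (𝓡 2) p →L[ℝ] ℝ) :
    S.hodgeStar p (a • β) = a • S.hodgeStar p β := by
  ext v
  simp only [_root_.smul_apply, hodgeStar_apply, map_smul]
  exact (S.vol p).toMultilinearMap.cons_smul ![v] _ _

/-- The smooth `1`-forms `α` with `* α = ε α`: the self-dual forms for `ε = 1` and the
anti-self-dual forms for `ε = -1`. -/
def dualForms (ε : ℝ) : Submodule ℝ (RawForm N 1) where
  carrier := {α | α.IsSmooth ∧ ∀ p, S.hodgeStar p (covector (α p)) = ε • covector (α p)}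
  add_mem' := fun {α β} hα hβ => ⟨(smoothForms N 1).add_mem hα.1 hβ.1, fun p => by
    rw [Pi.add_apply, covector_add, hodgeStar_add, hα.2, hβ.2, smul_add]⟩
  zero_mem' := ⟨(smoothForms N 1).zero_mem, fun p => by
    have := S.hodgeStar_smul p 0 0
    rw [zero_smul, zero_smul] at this
    rw [Pi.zero_apply, covector_zero, this, smul_zero]⟩
  smul_mem' := fun a α hα => ⟨(smoothForms N 1).smul_mem a hα.1, fun p => by
    rw [Pi.smul_apply, covector_smul, hodgeStar_smul, hα.2, smul_comm]⟩

/-- The subcomplex `0 → {α ∈ Ω¹ | * α = ε α} → Ω²` of the de Rham complex. (Forms of degree larger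
than two vanish on a surface.) -/
def dualComplex (ε : ℝ) : DeRhamSubcomplex N where
  carrier
    | 0 => ⊥
    | 1 => S.dualForms ε
    | k + 2 => smoothForms N (k + 2)
  smooth {k α} hα := by
    match k, α, hα with
    | 0, α, hα =>
      rw [(Submodule.mem_bot ℝ).1 hα]
      exact (smoothForms N 0).zero_mem
    | 1, α, hα => exact hα.1
    | k + 2, α, hα => exact hα
  extd_mem {k α} hα := by
    match k, α, hα with
    | 0, α, hα =>
      have h := RawForm.extd_smul 0 (0 : RawForm N 0)
      rw [zero_smul, zero_smul] at h
      rw [(Submodule.mem_bot ℝ).1 hα, h]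
      exact (S.dualForms ε).zero_mem
    | 1, α, hα => exact RawForm.IsSmooth.extd hα.1
    | k + 2, α, hα => exact RawForm.IsSmooth.extd hα

/-- The self-dual boundary condition `𝔏⁺`; the complex itself is `S.selfDual.shifted`. -/
def selfDual : DeRhamSubcomplex N := S.dualComplex 1

/-- The anti-self-dual boundary condition `𝔏⁻`; the complex itself is `S.antiSelfDual.shifted`. -/
def antiSelfDual : DeRhamSubcomplex N := S.dualComplex (-1)

/-- A non-zero null vector pointing in one of the four directions. -/
def IsPointing (dir : NullDirection) (p : N) (v : TangentSpace (𝓡 2) p) : Prop :=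
  v ≠ 0 ∧ S.g p v v = 0 ∧
    match dir with
    | .ne => S.g p (S.time p) v < 0 ∧ 0 < S.orient p ![S.time p, v]
    | .nw => S.g p (S.time p) v < 0 ∧ S.orient p ![S.time p, v] < 0
    | .sw => 0 < S.g p (S.time p) v ∧ S.orient p ![S.time p, v] < 0
    | .se => 0 < S.g p (S.time p) v ∧ 0 < S.orient p ![S.time p, v]

/-- A smooth curve `[0,1] → N` all of whose tangent vectors are null vectors pointing in the given
direction. -/
def IsPointingCurve (dir : NullDirection) (γ : ℝ → N) : Prop :=
  ContMDiffOn 𝓘(ℝ, ℝ) (𝓡 2) ∞ γ (Icc 0 1) ∧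
    ∀ t ∈ Icc (0 : ℝ) 1, S.IsPointing dir (γ t)
      (mfderivWithin 𝓘(ℝ, ℝ) (𝓡 2) γ (Icc 0 1) t
        (show TangentSpace 𝓘(ℝ, ℝ) t from (1 : ℝ)))

/-- The set of all points of `K` and all endpoints of curves that start in `K` and point in the
given direction. -/
def J (dir : NullDirection) (K : Set N) : Set N :=
  {q | ∃ p ∈ K, q = p ∨ ∃ γ : ℝ → N, S.IsPointingCurve dir γ ∧ γ 0 = p ∧ γ 1 = q}

/-- The flow of a complete smooth vector field that points in the direction `dir` everywhere:
a `+`-chiral flow for `dir = ↗` and a `-`-chiral flow for `dir = ↖`. -/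
def IsChiralFlow (dir : NullDirection) (Θ : ℝ × N → N) : Prop :=
  IsFlow Θ ∧ ∃ n : ∀ p : N, TangentSpace (𝓡 2) p,
    ContMDiff (𝓡 2) (𝓡 2).tangent ∞ (fun p => (⟨p, n p⟩ : TangentBundle (𝓡 2) N)) ∧
    (∀ p, S.IsPointing dir p (n p)) ∧
    ∀ p, IsMIntegralCurve (fun s => Θ (s, p)) n

end LorentzStructure

end Lorentz

/-! ### Restricting cochains from the de Rham complex -/

section Restriction

variable {N : Type u} [TopologicalSpace N] [ChartedSpace (EuclideanSpace ℝ (Fin 2)) N]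
  [IsManifold (𝓡 2) ∞ N]

/-- The cochain `Γ` on the shifted de Rham complex is `-P`, for an operator `P` that lowers the form
degree by one. -/
def IsNegOf
    (P : ∀ {k : ℕ}, RawForm N (k + 1) → ∀ r : N, (Fin k → TangentSpace (𝓡 2) r) → ℝ)
    (Γ : Cochain (deRham N).compact.shifted (deRham N).shifted (-1)) : Prop :=
  ∀ (p q : ℤ) (h : p + -1 = q) (x : (deRham N).compact.shifted.X p) (k : ℕ)
    (hk : (k : ℤ) = q + 1) (hk' : ((k + 1 : ℕ) : ℤ) = p + 1) (r : N)
    (v : Fin k → TangentSpace (𝓡 2) r),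
    (deRham N).form ((Γ.v p q h).hom x) k hk r v =
      -P ((deRham N).compact.form x (k + 1) hk') r v

/-- The cochain `G` is the restriction to the subcomplex `A[1]` of the cochain `Γ` on the shifted
de Rham complex. -/
def IsRestriction (A : DeRhamSubcomplex N)
    (Γ : Cochain (deRham N).compact.shifted (deRham N).shifted (-1))
    (G : Cochain A.compact.shifted A.shifted (-1)) : Prop :=
  G.comp (Cochain.ofHom ((DeRhamSubcomplex.incl (A := A) (B := deRham N)
      fun _ _ h => A.smooth h)⟦(1 : ℤ)⟧')) (add_zero _) =
    (Cochain.ofHom ((DeRhamSubcomplex.incl (A := A.compact) (B := (deRham N).compact)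
      fun _ _ h => ⟨A.smooth h.1, h.2⟩)⟦(1 : ℤ)⟧')).comp Γ (zero_add _)

end Restriction

end

noncomputable section

/-! ### Parametric integrals and fiber integration on a product -/

section Euclidean

/-! Write H for the operator `pastForm`, α ↦ ∫_{s ≤ 0} Θ^* α. Everything follows from three
properties of H and a time reversal.

Homotopy. On ℝ × E, Cartan's formula for ∂_s gives, after integration over a segment [a,b], d∫ + ∫d
= (restriction to s = b) - (restriction to s = a). This is
`extDeriv_intervalIntegral_fiberContraction`. Apply it to Θ^* α in a chart, with a = -R and b = 0.
Properness of the flow provides an R such that points near a given one meet supp α only at times |s|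
< R. Hence H is locally an integral over a fixed segment, so it produces smooth forms; the term at
-R vanishes and the term at 0 is α. Thus dH + Hd = id in positive form degree (`extd_pastForm_add`)
and Hd = id on functions (`pastForm_extd_zero`). The differential of the shifted complex is -d, so
it is -H whose boundary is the inclusion.

Self-duality. By linear algebra in a plane, * β = ± β holds exactly when β vanishes on a null vector
of the matching direction (`hodgeStar_eq_iff`), here on the generator n of the flow. Since ∂_s is
mapped to n, H kills the 1-forms with α(n) = 0, as it must because there are no functions in the
subcomplex. Since the flow preserves n, contracting H α with n for a 2-form α integrates α(n, n) =
0, so H α is again (anti-)self-dual.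

Supports. If H α does not vanish at q, then Θ(s, q) lies in supp α for some s ≤ 0, and the flow line
from there to q is a null curve of the right direction. Properness makes the set of such q closed,
so it contains supp (H α).

The backward operator is the forward operator of the reversed flow (`forwardG_reversedFlow`), whose
generator -n points in the opposite direction and selects the same duality sign. -/

lemma hasFDerivAt_parametric_intervalIntegral {E G : Type*} [NormedAddCommGroup E]
    [NormedSpace ℝ E] [NormedAddCommGroup G] [NormedSpace ℝ G]
    {f : ℝ × E → G} {U : Set E} (hU : IsOpen U)
    (hf : ContDiffOn ℝ 1 f (univ ×ˢ U)) (a b : ℝ) {y : E} (hy : y ∈ U) :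
    HasFDerivAt (fun y => ∫ s in a..b, f (s, y))
      (∫ s in a..b, (fderiv ℝ f (s, y)).comp (ContinuousLinearMap.inr ℝ ℝ E)) y := by
  have hopen : IsOpen ((univ : Set ℝ) ×ˢ U) := isOpen_univ.prod hU
  have hdf : ∀ s, ∀ z ∈ U, HasFDerivAt (fun z => f (s, z))
      ((fderiv ℝ f (s, z)).comp (ContinuousLinearMap.inr ℝ ℝ E)) z := by
    intro s z hz
    have h1 : HasFDerivAt f (fderiv ℝ f (s, z)) (s, z) :=
      ((hf.contDiffAt (hopen.mem_nhds ⟨mem_univ s, hz⟩)).differentiableAt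
        (by simp)).hasFDerivAt
    exact h1.comp z (hasFDerivAt_prodMk_right s z)
  have hcD : ContinuousOn (fun x : ℝ × E => (fderiv ℝ f x).comp (ContinuousLinearMap.inr ℝ ℝ E))
      (univ ×ˢ U) :=
    (hf.continuousOn_fderiv_of_isOpen hopen le_rfl).clm_comp continuousOn_const
  have hslice : ∀ z ∈ U, Continuous fun s : ℝ => f (s, z) := fun z hz =>
    hf.continuousOn.comp_continuous (by fun_prop) fun s => ⟨mem_univ s, hz⟩
  have hsliceD : ∀ z ∈ U, Continuous fun s : ℝ =>
      (fderiv ℝ f (s, z)).comp (ContinuousLinearMap.inr ℝ ℝ E) := fun z hz =>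
    hcD.comp_continuous (f := fun s : ℝ => (s, z)) (by fun_prop) fun s => ⟨mem_univ s, hz⟩
  -- a uniform bound for the derivative near the compact segment
  obtain ⟨C, hC⟩ := (isCompact_uIcc (a := a) (b := b)).exists_bound_of_continuousOn
    (hsliceD y hy).continuousOn
  -- Tube lemma: relaxing C to C + 1 makes the bound an open condition, which then persists near y
  -- uniformly over the compact segment.
  have hnear : ∀ᶠ z in 𝓝 y, ∀ s ∈ uIcc a b,
      ‖(fderiv ℝ f (s, z)).comp (ContinuousLinearMap.inr ℝ ℝ E)‖ < C + 1 := by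
    refine isCompact_uIcc.eventually_forall_of_forall_eventually fun s hs => ?_
    have hca := hcD.continuousAt (hopen.mem_nhds (⟨mem_univ s, hy⟩ : (s, y) ∈ univ ×ˢ U))
    have hlt := hca.norm.eventually_lt_const ((hC s hs).trans_lt (lt_add_one C))
    exact (continuous_swap.tendsto (y, s)).eventually hlt
  refine intervalIntegral.hasFDerivAt_integral_of_dominated_of_fderiv_le
    (bound := fun _ => C + 1)
    (F' := fun z s => (fderiv ℝ f (s, z)).comp (ContinuousLinearMap.inr ℝ ℝ E))
    (Filter.inter_mem hnear (hU.mem_nhds hy)) ?_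
    ((hslice y hy).intervalIntegrable _ _) (hsliceD y hy).aestronglyMeasurable ?_
    intervalIntegrable_const ?_
  · filter_upwards [hU.mem_nhds hy] with z hz using (hslice z hz).aestronglyMeasurable
  · exact Filter.Eventually.of_forall fun s hs z hz => (hz.1 s (uIoc_subset_uIcc hs)).le
  · exact Filter.Eventually.of_forall fun s _ z hz => hdf s z hz.2

/-- The derivative is again a parametric integral of a smooth integrand, so one inducts on the
order. The target must vary in the induction, since the derivative takes values in `E →L[ℝ] G`;
keeping `E` and `G` in one universe allows this. -/
lemma contDiffOn_parametric_intervalIntegral {E G : Type} [NormedAddCommGroup E]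
    [NormedSpace ℝ E] [NormedAddCommGroup G] [NormedSpace ℝ G]
    {f : ℝ × E → G} {U : Set E} (hU : IsOpen U)
    (hf : ContDiffOn ℝ ∞ f (univ ×ˢ U)) (a b : ℝ) :
    ContDiffOn ℝ ∞ (fun y => ∫ s in a..b, f (s, y)) U := by
  have hopen : IsOpen ((univ : Set ℝ) ×ˢ U) := isOpen_univ.prod hU
  refine contDiffOn_infty.2 fun n => ?_
  induction n generalizing G with
  | zero =>
    refine contDiffOn_zero.2 fun y hy => ?_
    exact (hasFDerivAt_parametric_intervalIntegral hU (hf.of_le (by simp)) a b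
      hy).continuousAt.continuousWithinAt
  | succ n ih =>
    have hd := fun y (hy : y ∈ U) =>
      hasFDerivAt_parametric_intervalIntegral hU (hf.of_le (by simp)) a b hy
    refine (contDiffOn_succ_iff_fderiv_of_isOpen (n := n) hU).2
      ⟨fun y hy => (hd y hy).differentiableAt.differentiableWithinAt, by simp, ?_⟩
    have h1 := ih (f := fun x => (fderiv ℝ f x).comp (ContinuousLinearMap.inr ℝ ℝ E))
      ((hf.fderiv_of_isOpen hopen (by simp)).clm_comp contDiffOn_const)
    exact h1.congr fun y hy => (hd y hy).fderiv

/-- Alternatization as a continuous linear map. -/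
def ContinuousMultilinearMap.alternatizationCLM (E : Type*) [NormedAddCommGroup E]
    [NormedSpace ℝ E] (k : ℕ) :
    ContinuousMultilinearMap ℝ (fun _ : Fin k => E) ℝ →L[ℝ] E [⋀^Fin k]→L[ℝ] ℝ :=
  LinearMap.mkContinuous
    { toFun := fun f => f.alternatization
      map_add' := fun f g => map_add _ f g
      map_smul' := fun c f => by
        ext v
        simp [ContinuousMultilinearMap.alternatization_apply_apply, Finset.mul_sum,
          mul_smul_comm] }
    (Fintype.card (Equiv.Perm (Fin k))) fun f => by
      refine ContinuousAlternatingMap.opNorm_le_bound _ (by positivity) fun v => ?_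
      simp only [LinearMap.coe_mk, AddHom.coe_mk,
        ContinuousMultilinearMap.alternatization_apply_apply]
      refine (norm_sum_le _ _).trans ?_
      have hle : ∀ σ ∈ (Finset.univ : Finset (Equiv.Perm (Fin k))),
          ‖Equiv.Perm.sign σ • f (v ∘ σ)‖ ≤ ‖f‖ * ∏ i, ‖v i‖ := by
        intro σ _
        have h1 : ‖Equiv.Perm.sign σ • f (v ∘ σ)‖ = ‖f (v ∘ σ)‖ := by
          rcases Int.units_eq_one_or (Equiv.Perm.sign σ) with h | h <;> simp [h]
        rw [h1]
        refine (f.le_opNorm _).trans_eq ?_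
        congr 1
        exact Equiv.prod_comp σ fun i => ‖v i‖
      refine (Finset.sum_le_sum hle).trans_eq ?_
      simp [mul_assoc]

/-- All k! permutations contribute the same term, because the two signs cancel. After division by
k!, alternatization is a continuous left inverse of the inclusion of alternating into multilinear
maps, which transfers smoothness from the latter to the former. -/
lemma ContinuousMultilinearMap.alternatizationCLM_coe {E : Type*} [NormedAddCommGroup E]
    [NormedSpace ℝ E] {k : ℕ} (f : E [⋀^Fin k]→L[ℝ] ℝ) :
    alternatizationCLM E k f.toContinuousMultilinearMap =
      (Fintype.card (Equiv.Perm (Fin k)) : ℝ) • f := by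
  ext v
  change f.toContinuousMultilinearMap.alternatization v = _
  rw [ContinuousMultilinearMap.alternatization_apply_apply]
  have h : ∀ σ : Equiv.Perm (Fin k),
      Equiv.Perm.sign σ • f.toContinuousMultilinearMap (v ∘ σ) = f v := by
    intro σ
    change Equiv.Perm.sign σ • f.toAlternatingMap (v ∘ σ) = f v
    rw [f.toAlternatingMap.map_perm, smul_smul]
    simp
  rw [Finset.sum_congr rfl fun σ _ => h σ]
  simp

/-- The pullback of alternating forms depends smoothly on the form and on the linear map. -/
lemma ContDiffOn.compContinuousLinearMap_alternating {X E F : Type*} [NormedAddCommGroup X]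
    [NormedSpace ℝ X] [NormedAddCommGroup E] [NormedSpace ℝ E] [NormedAddCommGroup F]
    [NormedSpace ℝ F] {k : ℕ} {n : WithTop ℕ∞} {s : Set X} {f : X → F [⋀^Fin k]→L[ℝ] ℝ}
    {g : X → E →L[ℝ] F} (hf : ContDiffOn ℝ n f s) (hg : ContDiffOn ℝ n g s) :
    ContDiffOn ℝ n (fun x => (f x).compContinuousLinearMap (g x)) s := by
  -- For multilinear maps, pullback is itself a continuous multilinear expression in the k copies of
  -- the linear map, hence smooth.
  have h1 : ContDiffOn ℝ n (fun x =>
      ContinuousMultilinearMap.compContinuousLinearMapContinuousMultilinear ℝ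
        (fun _ : Fin k => E) (fun _ => F) ℝ (fun _ => g x)) s :=
    (ContinuousMultilinearMap.contDiff _).comp_contDiffOn (contDiffOn_pi.2 fun _ => hg)
  have h2 : ContDiffOn ℝ n (fun x => (f x).toContinuousMultilinearMap) s :=
    (ContinuousAlternatingMap.toContinuousMultilinearMapCLM (𝕜 := ℝ) (E := F) (F := ℝ)
      (ι := Fin k) ℝ).contDiff.comp_contDiffOn hf
  have h3 := ((Fintype.card (Equiv.Perm (Fin k)) : ℝ)⁻¹ •
    ContinuousMultilinearMap.alternatizationCLM E k).contDiff.comp_contDiffOn (h1.clm_apply h2)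
  refine h3.congr fun x _ => ?_
  have h4 := ContinuousMultilinearMap.alternatizationCLM_coe
    ((f x).compContinuousLinearMap (g x))
  have h5 : (Fintype.card (Equiv.Perm (Fin k)) : ℝ) ≠ 0 := by
    simp
  calc (f x).compContinuousLinearMap (g x)
      = (Fintype.card (Equiv.Perm (Fin k)) : ℝ)⁻¹ •
        ((Fintype.card (Equiv.Perm (Fin k)) : ℝ) • (f x).compContinuousLinearMap (g x)) := by
        rw [smul_smul, inv_mul_cancel₀ h5, one_smul]
    _ = _ := by rw [← h4]; rfl

variable {E : Type*} [NormedAddCommGroup E] [NormedSpace ℝ E]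

/-- Contraction of a form on `ℝ × E` with the unit vector of the first factor, restricted to
the second factor. -/
def fiberContraction (E : Type*) [NormedAddCommGroup E] [NormedSpace ℝ E] (k : ℕ) :
    (ℝ × E) [⋀^Fin (k + 1)]→L[ℝ] ℝ →L[ℝ] E [⋀^Fin k]→L[ℝ] ℝ :=
  (ContinuousAlternatingMap.compContinuousLinearMapCLM (ContinuousLinearMap.inr ℝ ℝ E)).comp
    ((ContinuousLinearMap.apply ℝ _ ((1 : ℝ), (0 : E))).comp
      (ContinuousAlternatingMap.curryLeftLI (𝕜 := ℝ) (E := ℝ × E) (F := ℝ)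
        (n := k)).toContinuousLinearMap)

lemma fiberContraction_apply {k : ℕ} (β : (ℝ × E) [⋀^Fin (k + 1)]→L[ℝ] ℝ) (v : Fin k → E) :
    fiberContraction E k β v = β (Fin.cons ((1 : ℝ), (0 : E)) fun i => ((0 : ℝ), v i)) := rfl

/-- Restriction of a form on `ℝ × E` to the second factor. -/
def fiberRestriction (E : Type*) [NormedAddCommGroup E] [NormedSpace ℝ E] (k : ℕ) :
    (ℝ × E) [⋀^Fin k]→L[ℝ] ℝ →L[ℝ] E [⋀^Fin k]→L[ℝ] ℝ :=
  ContinuousAlternatingMap.compContinuousLinearMapCLM (ContinuousLinearMap.inr ℝ ℝ E)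

lemma fiberRestriction_apply {k : ℕ} (β : (ℝ × E) [⋀^Fin k]→L[ℝ] ℝ) (v : Fin k → E) :
    fiberRestriction E k β v = β fun i => ((0 : ℝ), v i) := rfl

/-- Cartan's formula at a point, with `D` in the role of the derivative of a form β. The unit vector
in the first slot shifts the indices of the `v i` by one in ι dβ, so these terms have the opposite
sign to those of d(ι β) and cancel. Only the derivative along ∂_s survives. -/
lemma alternatizeUncurryFin_add_fiberContraction {k : ℕ}
    (D : ℝ × E →L[ℝ] (ℝ × E) [⋀^Fin (k + 1)]→L[ℝ] ℝ) :
    ContinuousAlternatingMap.alternatizeUncurryFin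
        ((fiberContraction E k).comp (D.comp (ContinuousLinearMap.inr ℝ ℝ E))) +
      fiberContraction E (k + 1) (ContinuousAlternatingMap.alternatizeUncurryFin D) =
    fiberRestriction E (k + 1) (D (1, 0)) := by
  ext v
  rw [ContinuousAlternatingMap.add_apply, ContinuousAlternatingMap.alternatizeUncurryFin_apply,
    fiberContraction_apply, ContinuousAlternatingMap.alternatizeUncurryFin_apply,
    Fin.sum_univ_succ (n := k + 1), fiberRestriction_apply]
  have h : ∀ i : Fin (k + 1), i.succ.removeNth (α := fun _ => ℝ × E)
      (Fin.cons ((1 : ℝ), (0 : E)) fun i => ((0 : ℝ), v i)) =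
      Fin.cons ((1 : ℝ), (0 : E)) fun j => ((0 : ℝ), i.removeNth v j) := by
    intro i
    funext j
    refine Fin.cases ?_ (fun j => ?_) j
    · simp [Fin.removeNth]
    · simp [Fin.removeNth]
  simp only [h]
  simp only [Fin.val_zero, pow_zero, one_smul, Fin.cons_zero, Fin.cons_succ, Fin.val_succ,
    pow_succ, mul_neg, mul_one, neg_smul, Finset.sum_neg_distrib]
  have h0 : (0 : Fin (k + 2)).removeNth (α := fun _ => ℝ × E)
      (Fin.cons ((1 : ℝ), (0 : E)) fun i => ((0 : ℝ), v i)) = fun i => ((0 : ℝ), v i) := by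
    funext j
    simp [Fin.removeNth]
  rw [h0]
  change (∑ i : Fin (k + 1), (-1) ^ (i : ℕ) •
    D (0, v i) (Fin.cons ((1 : ℝ), (0 : E)) fun j => ((0 : ℝ), i.removeNth v j))) + _ = _
  abel

/-- Cartan's formula for functions, where the term d(ι β) is absent. -/
lemma fiberContraction_alternatizeUncurryFin_zero
    (D : ℝ × E →L[ℝ] (ℝ × E) [⋀^Fin 0]→L[ℝ] ℝ) :
    fiberContraction E 0 (ContinuousAlternatingMap.alternatizeUncurryFin D) =
    fiberRestriction E 0 (D (1, 0)) := by
  ext v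
  rw [fiberContraction_apply, ContinuousAlternatingMap.alternatizeUncurryFin_apply,
    fiberRestriction_apply]
  simp only [Fin.sum_univ_succ, Finset.univ_eq_empty, Finset.sum_empty, add_zero, Fin.val_zero,
    pow_zero, one_smul, Fin.cons_zero]
  congr 1

variable {U : Set E} {k : ℕ}

lemma intervalIntegral_fiberRestriction_fderiv (hU : IsOpen U)
    {β : ℝ × E → (ℝ × E) [⋀^Fin k]→L[ℝ] ℝ} (hβ : ContDiffOn ℝ ∞ β (univ ×ˢ U)) (a b : ℝ)
    {y : E} (hy : y ∈ U) :
    ∫ s in a..b, fiberRestriction E k (fderiv ℝ β (s, y) (1, 0)) =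
      fiberRestriction E k (β (b, y)) - fiberRestriction E k (β (a, y)) := by
  have hopen : IsOpen ((univ : Set ℝ) ×ˢ U) := isOpen_univ.prod hU
  refine intervalIntegral.integral_eq_sub_of_hasDerivAt
    (f := fun s => fiberRestriction E k (β (s, y))) (fun s _ => ?_) ?_
  · have h1 : HasFDerivAt β (fderiv ℝ β (s, y)) (s, y) :=
      ((hβ.contDiffAt (hopen.mem_nhds ⟨mem_univ s, hy⟩)).differentiableAt (by simp)).hasFDerivAt
    have h2 : HasDerivAt (fun s : ℝ => (s, y)) ((1 : ℝ), (0 : E)) s :=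
      (hasDerivAt_id s).prodMk (hasDerivAt_const s y)
    exact (fiberRestriction E k).hasFDerivAt.comp_hasDerivAt s (h1.comp_hasDerivAt s h2)
  · refine Continuous.intervalIntegrable ?_ _ _
    refine (fiberRestriction E k).continuous.comp (Continuous.clm_apply ?_ continuous_const)
    exact (hβ.continuousOn_fderiv_of_isOpen hopen (by simp)).comp_continuous
      (f := fun s : ℝ => (s, y)) (by fun_prop) fun s => ⟨mem_univ s, hy⟩

lemma continuous_fiberContraction_extDeriv (hU : IsOpen U)
    {β : ℝ × E → (ℝ × E) [⋀^Fin k]→L[ℝ] ℝ} (hβ : ContDiffOn ℝ ∞ β (univ ×ˢ U))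
    {y : E} (hy : y ∈ U) :
    Continuous fun s : ℝ => fiberContraction E k (extDeriv β (s, y)) := by
  have hopen : IsOpen ((univ : Set ℝ) ×ˢ U) := isOpen_univ.prod hU
  refine (fiberContraction E k).continuous.comp
    ((ContinuousAlternatingMap.alternatizeUncurryFinCLM ℝ (ℝ × E) ℝ).continuous.comp ?_)
  exact (hβ.continuousOn_fderiv_of_isOpen hopen (by simp)).comp_continuous
    (f := fun s : ℝ => (s, y)) (by fun_prop) fun s => ⟨mem_univ s, hy⟩

/-- Fiber integration over a segment is a homotopy between the restrictions to its ends. -/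
lemma extDeriv_intervalIntegral_fiberContraction (hU : IsOpen U)
    {β : ℝ × E → (ℝ × E) [⋀^Fin (k + 1)]→L[ℝ] ℝ} (hβ : ContDiffOn ℝ ∞ β (univ ×ˢ U)) (a b : ℝ)
    {y : E} (hy : y ∈ U) :
    extDeriv (fun y => ∫ s in a..b, fiberContraction E k (β (s, y))) y +
      ∫ s in a..b, fiberContraction E (k + 1) (extDeriv β (s, y)) =
      fiberRestriction E (k + 1) (β (b, y)) - fiberRestriction E (k + 1) (β (a, y)) := by
  have hopen : IsOpen ((univ : Set ℝ) ×ˢ U) := isOpen_univ.prod hU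
  have hη : ContDiffOn ℝ ∞ (fun x => fiberContraction E k (β x)) (univ ×ˢ U) :=
    (fiberContraction E k).contDiff.comp_contDiffOn hβ
  have hfd : ∀ s : ℝ, (fderiv ℝ (fun x => fiberContraction E k (β x)) (s, y)).comp
      (ContinuousLinearMap.inr ℝ ℝ E) =
      (fiberContraction E k).comp ((fderiv ℝ β (s, y)).comp (ContinuousLinearMap.inr ℝ ℝ E)) := by
    intro s
    have h1 : HasFDerivAt β (fderiv ℝ β (s, y)) (s, y) :=
      ((hβ.contDiffAt (hopen.mem_nhds ⟨mem_univ s, hy⟩)).differentiableAt (by simp)).hasFDerivAt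
    have h2 : HasFDerivAt (fun x => fiberContraction E k (β x)) _ (s, y) :=
      (fiberContraction E k).hasFDerivAt.comp (s, y) h1
    rw [h2.fderiv]
    rfl
  have hcont : Continuous fun s : ℝ => (fiberContraction E k).comp
      ((fderiv ℝ β (s, y)).comp (ContinuousLinearMap.inr ℝ ℝ E)) := by
    have : Continuous fun s : ℝ => fderiv ℝ β (s, y) :=
      (hβ.continuousOn_fderiv_of_isOpen hopen (by simp)).comp_continuous
        (f := fun s : ℝ => (s, y)) (by fun_prop) fun s => ⟨mem_univ s, hy⟩
    exact continuous_const.clm_comp (this.clm_comp continuous_const)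
  have hL : ContinuousAlternatingMap.alternatizeUncurryFinCLM ℝ E ℝ
      (∫ s in a..b, (fiberContraction E k).comp
        ((fderiv ℝ β (s, y)).comp (ContinuousLinearMap.inr ℝ ℝ E))) =
      ∫ s in a..b, ContinuousAlternatingMap.alternatizeUncurryFinCLM ℝ E ℝ
        ((fiberContraction E k).comp
          ((fderiv ℝ β (s, y)).comp (ContinuousLinearMap.inr ℝ ℝ E))) :=
    (ContinuousLinearMap.intervalIntegral_comp_comm (𝕜 := ℝ)
      (E := E →L[ℝ] E [⋀^Fin k]→L[ℝ] ℝ) (F := E [⋀^Fin (k + 1)]→L[ℝ] ℝ)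
      (ContinuousAlternatingMap.alternatizeUncurryFinCLM ℝ E ℝ)
      (hcont.intervalIntegrable (μ := volume) a b)).symm
  -- Differentiation under the integral turns the left side into one integral, to which the
  -- pointwise Cartan formula and then the fundamental theorem of calculus in s apply.
  rw [extDeriv, (hasFDerivAt_parametric_intervalIntegral hU (hη.of_le (by simp)) a b hy).fderiv]
  simp only [hfd]
  rw [← ContinuousAlternatingMap.alternatizeUncurryFinCLM_apply (𝕜 := ℝ),
    hL, ← intervalIntegral.integral_add, ← intervalIntegral_fiberRestriction_fderiv hU hβ a b hy]
  · refine intervalIntegral.integral_congr fun s _ => ?_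
    exact alternatizeUncurryFin_add_fiberContraction (fderiv ℝ β (s, y))
  · exact ((ContinuousAlternatingMap.alternatizeUncurryFinCLM ℝ E ℝ).continuous.comp
      hcont).intervalIntegrable a b
  · exact (continuous_fiberContraction_extDeriv hU hβ hy).intervalIntegrable a b

lemma intervalIntegral_fiberContraction_extDeriv_zero (hU : IsOpen U)
    {β : ℝ × E → (ℝ × E) [⋀^Fin 0]→L[ℝ] ℝ} (hβ : ContDiffOn ℝ ∞ β (univ ×ˢ U)) (a b : ℝ)
    {y : E} (hy : y ∈ U) :
    ∫ s in a..b, fiberContraction E 0 (extDeriv β (s, y)) =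
      fiberRestriction E 0 (β (b, y)) - fiberRestriction E 0 (β (a, y)) := by
  rw [← intervalIntegral_fiberRestriction_fderiv hU hβ a b hy]
  exact intervalIntegral.integral_congr fun s _ =>
    fiberContraction_alternatizeUncurryFin_zero (fderiv ℝ β (s, y))

end Euclidean

/-! ### Pullback of forms to normed spaces -/

section Pullback

variable {N : Type u} [TopologicalSpace N] [ChartedSpace (EuclideanSpace ℝ (Fin 2)) N]
  {W : Type*} [NormedAddCommGroup W] [NormedSpace ℝ W]

/-- The pullback of a form along a map from a normed space. -/
def RawForm.pullback {k : ℕ} (α : RawForm N k) (F : W → N) (x : W) : W [⋀^Fin k]→L[ℝ] ℝ :=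
  (α (F x)).compContinuousLinearMap (mfderiv 𝓘(ℝ, W) (𝓡 2) F x)

lemma RawForm.pullback_apply {k : ℕ} (α : RawForm N k) (F : W → N) (x : W) (v : Fin k → W) :
    α.pullback F x v = α (F x) fun i => mfderiv 𝓘(ℝ, W) (𝓡 2) F x (v i) := rfl

lemma RawForm.extd_neg {k : ℕ} (α : RawForm N k) : (-α).extd = -α.extd := by
  have h : ∀ {m : ℕ} (β : RawForm N m), (-1 : ℝ) • β = -β := fun β => by
    funext p
    exact neg_one_smul ℝ (β p)
  rw [← h, ← h, RawForm.extd_smul]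

variable {F : W → N} {O : Set W}

lemma isOpen_chart_preimage (hO : IsOpen O) (hF : ContMDiffOn 𝓘(ℝ, W) (𝓡 2) ∞ F O) (c : N) :
    IsOpen (O ∩ F ⁻¹' (extChartAt (𝓡 2) c).source) :=
  hF.continuousOn.isOpen_inter_preimage hO (isOpen_extChartAt_source c)

variable [IsManifold (𝓡 2) ∞ N]

/-- Reduces identities of forms on `N` to Euclidean calculus, one chart centre at a time. -/
lemma RawForm.ext_chartRep {k : ℕ} {α β : RawForm N k}
    (h : ∀ p, α.chartRep p (extChartAt (𝓡 2) p p) = β.chartRep p (extChartAt (𝓡 2) p p)) :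
    α = β := by
  funext p
  rw [← RawForm.chartRep_comp_mfderiv α p (mem_extChartAt_source p),
    ← RawForm.chartRep_comp_mfderiv β p (mem_extChartAt_source p), h]

lemma RawForm.pullback_eq_chartRep {k : ℕ} (α : RawForm N k) (hO : IsOpen O)
    (hF : ContMDiffOn 𝓘(ℝ, W) (𝓡 2) ∞ F O) (c : N) {x : W} (hx : x ∈ O)
    (hxc : F x ∈ (extChartAt (𝓡 2) c).source) :
    α.pullback F x = (α.chartRep c ((extChartAt (𝓡 2) c ∘ F) x)).compContinuousLinearMap
      (fderiv ℝ (extChartAt (𝓡 2) c ∘ F) x) := by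
  have hFx : MDifferentiableAt 𝓘(ℝ, W) (𝓡 2) F x :=
    (hF.contMDiffAt (hO.mem_nhds hx)).mdifferentiableAt (by simp)
  have hc : MDifferentiableAt (𝓡 2) 𝓘(ℝ, EuclideanSpace ℝ (Fin 2)) (extChartAt (𝓡 2) c) (F x) :=
    (contMDiffAt_extChartAt' (n := ∞) (by rwa [extChartAt_source] at hxc)).mdifferentiableAt
      (by simp)
  have hchain : fderiv ℝ (extChartAt (𝓡 2) c ∘ F) x =
      (mfderiv (𝓡 2) 𝓘(ℝ, EuclideanSpace ℝ (Fin 2)) (extChartAt (𝓡 2) c) (F x)).comp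
        (mfderiv 𝓘(ℝ, W) (𝓡 2) F x) := by
    rw [← mfderiv_eq_fderiv]
    exact mfderiv_comp x hc hFx
  rw [hchain, RawForm.pullback, ← RawForm.chartRep_comp_mfderiv α c hxc]
  rfl

lemma contDiffOn_extChartAt_comp (hF : ContMDiffOn 𝓘(ℝ, W) (𝓡 2) ∞ F O) (c : N) :
    ContDiffOn ℝ ∞ (extChartAt (𝓡 2) c ∘ F) (O ∩ F ⁻¹' (extChartAt (𝓡 2) c).source) := by
  rw [← contMDiffOn_iff_contDiffOn]
  refine ContMDiffOn.comp (t := (extChartAt (𝓡 2) c).source) ?_ (hF.mono inter_subset_left)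
    inter_subset_right
  rw [extChartAt_source]
  exact contMDiffOn_extChartAt

lemma RawForm.IsSmooth.contDiffOn_pullback {k : ℕ} {α : RawForm N k} (hα : α.IsSmooth)
    (hO : IsOpen O) (hF : ContMDiffOn 𝓘(ℝ, W) (𝓡 2) ∞ F O) :
    ContDiffOn ℝ ∞ (α.pullback F) O := by
  intro x hx
  have hV := isOpen_chart_preimage hO hF (F x)
  have hψ := contDiffOn_extChartAt_comp hF (F x)
  have hxV : x ∈ O ∩ F ⁻¹' (extChartAt (𝓡 2) (F x)).source := ⟨hx, mem_extChartAt_source (F x)⟩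
  have h1 : ContDiffOn ℝ ∞ (fun z =>
      α.chartRep (F x) ((extChartAt (𝓡 2) (F x) ∘ F) z)) _ :=
    (hα (F x)).comp hψ fun z hz => (extChartAt (𝓡 2) (F x)).map_source hz.2
  have h2 := h1.compContinuousLinearMap_alternating (hψ.fderiv_of_isOpen hV (by simp))
  have h3 : ContDiffOn ℝ ∞ (α.pullback F) _ :=
    h2.congr fun z hz => RawForm.pullback_eq_chartRep α hO hF (F x) hz.1 hz.2
  exact (h3.contDiffAt (hV.mem_nhds hxV)).contDiffWithinAt

/-- Naturality of d. Near x the form is a Euclidean pullback of a chart representative, where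
naturality is known, and d is computed by the chart representative. -/
lemma RawForm.IsSmooth.extDeriv_pullback {k : ℕ} {α : RawForm N k} (hα : α.IsSmooth)
    (hO : IsOpen O) (hF : ContMDiffOn 𝓘(ℝ, W) (𝓡 2) ∞ F O) {x : W} (hx : x ∈ O) :
    extDeriv (α.pullback F) x = α.extd.pullback F x := by
  have hV := isOpen_chart_preimage hO hF (F x)
  have hψ := contDiffOn_extChartAt_comp hF (F x)
  have hxV : x ∈ O ∩ F ⁻¹' (extChartAt (𝓡 2) (F x)).source := ⟨hx, mem_extChartAt_source (F x)⟩
  have hev : α.pullback F =ᶠ[𝓝 x] fun z =>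
      (α.chartRep (F x) ((extChartAt (𝓡 2) (F x) ∘ F) z)).compContinuousLinearMap
        (fderiv ℝ (extChartAt (𝓡 2) (F x) ∘ F) z) := by
    filter_upwards [hV.mem_nhds hxV] with z hz
    exact RawForm.pullback_eq_chartRep α hO hF (F x) hz.1 hz.2
  have ht := mem_extChartAt_target (I := 𝓡 2) (F x)
  have hdiff : DifferentiableAt ℝ (α.chartRep (F x)) ((extChartAt (𝓡 2) (F x) ∘ F) x) :=
    ((hα (F x)).contDiffAt ((isOpen_extChartAt_target (F x)).mem_nhds ht)).differentiableAt
      (by simp)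
  rw [hev.extDeriv_eq, _root_.extDeriv_pullback hdiff (hψ.contDiffAt (hV.mem_nhds hxV))
    (by simp; exact WithTop.coe_le_coe.2 le_top),
    RawForm.pullback_eq_chartRep α.extd hO hF (F x) hx (mem_extChartAt_source (F x))]
  exact congrArg (ContinuousAlternatingMap.compContinuousLinearMap · _)
    (RawForm.chartRep_extd hα (F x) ht).symm

end Pullback

/-! ### Integration of forms along a flow -/

section FlowIntegral

variable {N : Type u} [TopologicalSpace N] [ChartedSpace (EuclideanSpace ℝ (Fin 2)) N]

/-- The integrand of the fiber integral as an alternating form. -/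
def flowIntegrand (Θ : ℝ × N → N) {k : ℕ} (α : RawForm N (k + 1)) (p : N) (s : ℝ) :
    EuclideanSpace ℝ (Fin 2) [⋀^Fin k]→L[ℝ] ℝ :=
  fiberContraction (EuclideanSpace ℝ (Fin 2)) k
    (show (ℝ × EuclideanSpace ℝ (Fin 2)) [⋀^Fin (k + 1)]→L[ℝ] ℝ from flowPullback Θ α (s, p))

lemma flowIntegrand_apply (Θ : ℝ × N → N) {k : ℕ} (α : RawForm N (k + 1)) (p : N) (s : ℝ)
    (v : Fin k → EuclideanSpace ℝ (Fin 2)) :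
    flowIntegrand Θ α p s v = flowPullback Θ α (s, p)
      (Fin.cons (show TangentSpace (𝓘(ℝ, ℝ).prod (𝓡 2)) (s, p) from ((1 : ℝ), 0))
        fun i => (show TangentSpace (𝓘(ℝ, ℝ).prod (𝓡 2)) (s, p) from ((0 : ℝ), v i))) := rfl

/-- The form `∫_{s ≤ 0} Θ^* α`. -/
def pastForm (Θ : ℝ × N → N) {k : ℕ} (α : RawForm N (k + 1)) : RawForm N k := fun p =>
  (show EuclideanSpace ℝ (Fin 2) [⋀^Fin k]→L[ℝ] ℝ from ∫ s in Iic (0 : ℝ), flowIntegrand Θ α p s)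

/-- A flow in the chart around `c`. -/
def chartFlow (Θ : ℝ × N → N) (c : N) (x : ℝ × EuclideanSpace ℝ (Fin 2)) : N :=
  Θ (x.1, (extChartAt (𝓡 2) c).symm x.2)

lemma flowIntegrand_eq_zero {Θ : ℝ × N → N} {k : ℕ} {α : RawForm N (k + 1)} {p : N} {s : ℝ}
    (h : α (Θ (s, p)) = 0) : flowIntegrand Θ α p s = 0 := by
  ext v
  rw [flowIntegrand_apply, flowPullback, h]
  rfl

lemma pastForm_smul (Θ : ℝ × N → N) {k : ℕ} (a : ℝ) (α : RawForm N (k + 1)) :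
    pastForm Θ (a • α) = a • pastForm Θ α := by
  funext p
  exact integral_smul a (fun s => flowIntegrand Θ α p s)

variable [IsManifold (𝓡 2) ∞ N] {Θ : ℝ × N → N}

lemma contMDiffOn_chartFlow (hΘ : ContMDiff (𝓘(ℝ, ℝ).prod (𝓡 2)) (𝓡 2) ∞ Θ) (c : N) :
    ContMDiffOn 𝓘(ℝ, ℝ × EuclideanSpace ℝ (Fin 2)) (𝓡 2) ∞ (chartFlow Θ c)
      (univ ×ˢ (extChartAt (𝓡 2) c).target) := by
  refine hΘ.comp_contMDiffOn (ContMDiffOn.prodMk ?_ ?_)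
  · exact (contMDiff_iff_contDiff.2 contDiff_fst).contMDiffOn
  · exact (contMDiffOn_extChartAt_symm c).comp
      (contMDiff_iff_contDiff.2 contDiff_snd).contMDiffOn fun x hx => hx.2

lemma mfderiv_chartFlow (hΘ : ContMDiff (𝓘(ℝ, ℝ).prod (𝓡 2)) (𝓡 2) ∞ Θ) (c : N)
    {y : EuclideanSpace ℝ (Fin 2)} (hy : y ∈ (extChartAt (𝓡 2) c).target) (s a : ℝ)
    (v : EuclideanSpace ℝ (Fin 2)) :
    mfderiv 𝓘(ℝ, ℝ × EuclideanSpace ℝ (Fin 2)) (𝓡 2) (chartFlow Θ c) (s, y) (a, v) =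
      mfderiv (𝓘(ℝ, ℝ).prod (𝓡 2)) (𝓡 2) Θ (s, (extChartAt (𝓡 2) c).symm y)
        (a, mfderiv 𝓘(ℝ, EuclideanSpace ℝ (Fin 2)) (𝓡 2) (extChartAt (𝓡 2) c).symm y v) := by
  have h1 : HasMFDerivAt 𝓘(ℝ, ℝ × EuclideanSpace ℝ (Fin 2)) 𝓘(ℝ, ℝ)
      (Prod.fst : ℝ × EuclideanSpace ℝ (Fin 2) → ℝ) (s, y)
      (ContinuousLinearMap.fst ℝ ℝ (EuclideanSpace ℝ (Fin 2))) :=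
    hasFDerivAt_fst.hasMFDerivAt
  have h2 : HasMFDerivAt 𝓘(ℝ, ℝ × EuclideanSpace ℝ (Fin 2)) 𝓘(ℝ, EuclideanSpace ℝ (Fin 2))
      (Prod.snd : ℝ × EuclideanSpace ℝ (Fin 2) → EuclideanSpace ℝ (Fin 2)) (s, y)
      (ContinuousLinearMap.snd ℝ ℝ (EuclideanSpace ℝ (Fin 2))) :=
    hasFDerivAt_snd.hasMFDerivAt
  have h3 : HasMFDerivAt 𝓘(ℝ, EuclideanSpace ℝ (Fin 2)) (𝓡 2) (extChartAt (𝓡 2) c).symm y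
      (mfderiv 𝓘(ℝ, EuclideanSpace ℝ (Fin 2)) (𝓡 2) (extChartAt (𝓡 2) c).symm y) :=
    (((contMDiffOn_extChartAt_symm (n := ∞) c).contMDiffAt
      ((isOpen_extChartAt_target c).mem_nhds hy)).mdifferentiableAt (by simp)).hasMFDerivAt
  have h4 : HasMFDerivAt (𝓘(ℝ, ℝ).prod (𝓡 2)) (𝓡 2) Θ (s, (extChartAt (𝓡 2) c).symm y)
      (mfderiv (𝓘(ℝ, ℝ).prod (𝓡 2)) (𝓡 2) Θ (s, (extChartAt (𝓡 2) c).symm y)) :=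
    (hΘ.mdifferentiable (by simp) _).hasMFDerivAt
  have h5 := h4.comp (s, y) (h1.prodMk (h3.comp (s, y) h2))
  exact DFunLike.congr_fun h5.mfderiv (a, v)

/-- A chart changes only the second factor of ℝ × N, so it commutes with contraction by ∂_s. The
integrand thereby becomes a contraction on ℝ × (chart target), to which the Euclidean homotopy
formula applies. -/
lemma flowIntegrand_chart (hΘ : ContMDiff (𝓘(ℝ, ℝ).prod (𝓡 2)) (𝓡 2) ∞ Θ) {k : ℕ}
    (α : RawForm N (k + 1)) (c : N) {y : EuclideanSpace ℝ (Fin 2)}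
    (hy : y ∈ (extChartAt (𝓡 2) c).target) (s : ℝ) :
    (flowIntegrand Θ α ((extChartAt (𝓡 2) c).symm y) s).compContinuousLinearMap
      (show EuclideanSpace ℝ (Fin 2) →L[ℝ] EuclideanSpace ℝ (Fin 2) from
        mfderiv 𝓘(ℝ, EuclideanSpace ℝ (Fin 2)) (𝓡 2) (extChartAt (𝓡 2) c).symm y) =
    fiberContraction _ k (α.pullback (chartFlow Θ c) (s, y)) := by
  ext v
  rw [fiberContraction_apply, RawForm.pullback_apply]
  change α (Θ (s, (extChartAt (𝓡 2) c).symm y)) _ = α (Θ (s, (extChartAt (𝓡 2) c).symm y)) _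
  congr 1
  funext i
  refine Fin.cases ?_ (fun i => ?_) i
  · refine Eq.trans ?_ (mfderiv_chartFlow hΘ c hy s 1 0).symm
    have h0 : mfderiv 𝓘(ℝ, EuclideanSpace ℝ (Fin 2)) (𝓡 2) (extChartAt (𝓡 2) c).symm y 0 = 0 :=
      map_zero _
    exact (congrArg (fun w : EuclideanSpace ℝ (Fin 2) => mfderiv (𝓘(ℝ, ℝ).prod (𝓡 2)) (𝓡 2) Θ
      (s, (extChartAt (𝓡 2) c).symm y) ((1 : ℝ), w)) h0).symm
  · exact (mfderiv_chartFlow hΘ c hy s 0 (v i)).symm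

end FlowIntegral

/-! ### Supports, smoothness and the homotopy formula for proper flows -/

section ProperFlow

variable {N : Type u} [TopologicalSpace N] [ChartedSpace (EuclideanSpace ℝ (Fin 2)) N]
  {Θ : ℝ × N → N}

/-- Along a proper flow, the points near a given one meet a compact set in bounded time only. -/
lemma IsProperFlow.exists_bound (hp : IsProperFlow Θ) {K : Set N} (hK : IsCompact K) (p : N) :
    ∃ R : ℝ, 0 < R ∧ ∀ᶠ q in 𝓝 p, ∀ s, Θ (s, q) ∈ K → |s| < R := by
  have : LocallyCompactSpace N := Manifold.locallyCompact_of_finiteDimensional (𝓡 2)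
  obtain ⟨L, hL, hLp⟩ := exists_compact_mem_nhds p
  -- Properness of the shear map makes the set of times at which some point of `L` meets `K`
  -- compact, hence bounded.
  have hc : IsCompact (Prod.fst '' ((fun x : ℝ × N => (x.2, Θ x)) ⁻¹' (L ×ˢ K))) :=
    (hp.isCompact_preimage (hL.prod hK)).image continuous_fst
  obtain ⟨R, hR⟩ := hc.isBounded.exists_norm_le
  refine ⟨max R 0 + 1, by positivity, ?_⟩
  filter_upwards [hLp] with q hq s hs
  have := hR s ⟨(s, q), ⟨hq, hs⟩, rfl⟩
  rw [Real.norm_eq_abs] at this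
  exact (this.trans (le_max_left R 0)).trans_lt (lt_add_one _)

/-- Near a point of the complement, times before -R are excluded by properness, and the remaining
segment [-R, 0] by the tube lemma. Closedness is needed because a support is a closure. -/
lemma IsProperFlow.isClosed_future [T2Space N] (hp : IsProperFlow Θ) (hΘ : IsFlow Θ)
    {K : Set N} (hK : IsCompact K) : IsClosed {q | ∃ s ≤ 0, Θ (s, q) ∈ K} := by
  rw [← isOpen_compl_iff, isOpen_iff_mem_nhds]
  intro p hpK
  obtain ⟨R, hR, hev⟩ := hp.exists_bound hK p
  have hcont : Continuous Θ := hΘ.contMDiff.continuous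
  have h1 : ∀ᶠ q in 𝓝 p, ∀ s ∈ Icc (-R) 0, Θ (s, q) ∉ K := by
    refine isCompact_Icc.eventually_forall_of_forall_eventually fun s hs => ?_
    have hn : Θ (s, p) ∉ K := fun h => hpK ⟨s, hs.2, h⟩
    have h2 : Continuous fun z : N × ℝ => Θ (z.2, z.1) := by fun_prop
    exact (hK.isClosed.isOpen_compl.preimage h2).mem_nhds hn
  filter_upwards [hev, h1] with q hq hq1
  rintro ⟨s, hs, hsK⟩
  exact hq1 s ⟨(abs_lt.1 (hq s hsK)).1.le, hs⟩ hsK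

lemma RawForm.eq_zero_of_notMem_supp {k : ℕ} {α : RawForm N k} {p : N} (h : p ∉ α.supp) :
    α p = 0 := by
  by_contra hne
  exact h (subset_closure hne)

lemma supp_pastForm_subset [T2Space N] (hp : IsProperFlow Θ) (hΘ : IsFlow Θ) {k : ℕ}
    {α : RawForm N (k + 1)} (hα : IsCompact α.supp) :
    (pastForm Θ α).supp ⊆ {q | ∃ s ≤ 0, Θ (s, q) ∈ α.supp} := by
  refine closure_minimal (fun q hq => ?_) (hp.isClosed_future hΘ hα)
  by_contra hn
  refine hq ?_
  have : ∀ s ∈ Iic (0 : ℝ), flowIntegrand Θ α q s = 0 := fun s hs =>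
    flowIntegrand_eq_zero (RawForm.eq_zero_of_notMem_supp fun h => hn ⟨s, hs, h⟩)
  exact (setIntegral_congr_fun measurableSet_Iic this).trans (integral_zero _ _)

lemma pastForm_eq_intervalIntegral {k : ℕ} {α : RawForm N (k + 1)} {p : N} {R : ℝ} (hR : 0 < R)
    (h : ∀ s, Θ (s, p) ∈ α.supp → |s| < R) :
    pastForm Θ α p = (show EuclideanSpace ℝ (Fin 2) [⋀^Fin k]→L[ℝ] ℝ from
      ∫ s in (-R)..0, flowIntegrand Θ α p s) := by
  rw [intervalIntegral.integral_of_le (by linarith)]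
  refine (setIntegral_eq_of_subset_of_forall_sdiff_eq_zero
    (E := EuclideanSpace ℝ (Fin 2) [⋀^Fin k]→L[ℝ] ℝ) measurableSet_Iic
    (fun s hs => hs.2) fun s hs => ?_)
  refine flowIntegrand_eq_zero (RawForm.eq_zero_of_notMem_supp fun hmem => hs.2 ⟨?_, hs.1⟩)
  exact (abs_lt.1 (h s hmem)).1

lemma pullback_chartFlow_eq_zero {k : ℕ} {α : RawForm N k} {c : N} {s : ℝ}
    {y : EuclideanSpace ℝ (Fin 2)} (h : Θ (s, (extChartAt (𝓡 2) c).symm y) ∉ α.supp) :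
    α.pullback (chartFlow Θ c) (s, y) = 0 := by
  have h0 : α (chartFlow Θ c (s, y)) = 0 := RawForm.eq_zero_of_notMem_supp h
  rw [RawForm.pullback, h0]
  rfl

variable [IsManifold (𝓡 2) ∞ N]

lemma flowIntegrand_eq_chart (hΘ : IsFlow Θ) {k : ℕ} (α : RawForm N (k + 1)) (p : N) (s : ℝ) :
    flowIntegrand Θ α p s =
      (fiberContraction _ k (α.pullback (chartFlow Θ p)
        (s, extChartAt (𝓡 2) p p))).compContinuousLinearMap
      (show EuclideanSpace ℝ (Fin 2) →L[ℝ] EuclideanSpace ℝ (Fin 2) from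
        mfderiv (𝓡 2) 𝓘(ℝ, EuclideanSpace ℝ (Fin 2)) (extChartAt (𝓡 2) p) p) := by
  rw [← flowIntegrand_chart hΘ.contMDiff α p (mem_extChartAt_target p)]
  exact (RawForm.chartRep_comp_mfderiv (fun q => flowIntegrand Θ α q s) p
    (mem_extChartAt_source p)).symm

lemma continuous_flowIntegrand (hΘ : IsFlow Θ) {k : ℕ} {α : RawForm N (k + 1)}
    (hα : α.IsSmooth) (p : N) : Continuous (flowIntegrand Θ α p) := by
  have hO := (isOpen_univ (X := ℝ)).prod (isOpen_extChartAt_target (I := 𝓡 2) p)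
  have h1 := (hα.contDiffOn_pullback hO (contMDiffOn_chartFlow hΘ.contMDiff p)).continuousOn
  have h2 : Continuous fun s : ℝ => α.pullback (chartFlow Θ p) (s, extChartAt (𝓡 2) p p) :=
    h1.comp_continuous (f := fun s : ℝ => (s, extChartAt (𝓡 2) p p)) (by fun_prop)
      fun s => ⟨mem_univ s, mem_extChartAt_target p⟩
  simp only [funext (flowIntegrand_eq_chart hΘ α p)]
  exact (ContinuousAlternatingMap.compContinuousLinearMapCLM _).continuous.comp
    ((fiberContraction (EuclideanSpace ℝ (Fin 2)) k).continuous.comp h2)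

lemma integrableOn_flowIntegrand (hΘ : IsFlow Θ) (hp : IsProperFlow Θ) {k : ℕ}
    {α : RawForm N (k + 1)} (hα : α.IsSmooth) (hc : IsCompact α.supp) (p : N) :
    IntegrableOn (flowIntegrand Θ α p) (Iic 0) := by
  obtain ⟨R, hR, hev⟩ := hp.exists_bound hc p
  refine ((continuous_flowIntegrand hΘ hα p).integrable_of_hasCompactSupport ?_).integrableOn
  refine HasCompactSupport.intro (isCompact_Icc (a := -R) (b := R)) fun s hs => ?_
  refine flowIntegrand_eq_zero (RawForm.eq_zero_of_notMem_supp fun hmem => hs ?_)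
  have := abs_lt.1 (hev.self_of_nhds s hmem)
  exact ⟨this.1.le, this.2.le⟩

lemma pastForm_add (hΘ : IsFlow Θ) (hp : IsProperFlow Θ) {k : ℕ}
    {α β : RawForm N (k + 1)} (hα : α.IsSmooth) (hαc : IsCompact α.supp)
    (hβ : β.IsSmooth) (hβc : IsCompact β.supp) :
    pastForm Θ (α + β) = pastForm Θ α + pastForm Θ β := by
  funext p
  exact integral_add (integrableOn_flowIntegrand hΘ hp hα hαc p)
    (integrableOn_flowIntegrand hΘ hp hβ hβc p)

/-- Evaluation at fixed vectors is continuous and linear, so it commutes with the integral of an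
integrable family of forms. This ties the form-valued integral to the scalar definition. -/
lemma pastForm_apply (hΘ : IsFlow Θ) (hp : IsProperFlow Θ) {k : ℕ}
    {α : RawForm N (k + 1)} (hα : α.IsSmooth) (hc : IsCompact α.supp) (p : N)
    (v : Fin k → TangentSpace (𝓡 2) p) : pastForm Θ α p v = forwardG Θ α p v := by
  have h := (ContinuousAlternatingMap.apply ℝ (EuclideanSpace ℝ (Fin 2)) ℝ
    (show Fin k → EuclideanSpace ℝ (Fin 2) from v)).integral_comp_comm
    (integrableOn_flowIntegrand hΘ hp hα hc p)
  exact h.symm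

/-- Near each point of a chart, the form `∫_{s ≤ 0} Θ^* α` is an integral over a fixed compact
segment. -/
lemma exists_chartRep_pastForm_eq (hΘ : IsFlow Θ) (hp : IsProperFlow Θ)
    {K : Set N} (hK : IsCompact K)
    (c : N) {y : EuclideanSpace ℝ (Fin 2)} (hy : y ∈ (extChartAt (𝓡 2) c).target) :
    ∃ R : ℝ, 0 < R ∧ (∀ s, Θ (s, (extChartAt (𝓡 2) c).symm y) ∈ K → |s| < R) ∧
      ∀ (k : ℕ) (α : RawForm N (k + 1)), α.IsSmooth → α.supp ⊆ K →
        (pastForm Θ α).chartRep c =ᶠ[𝓝 y] fun z =>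
          ∫ s in (-R)..0, fiberContraction _ k (α.pullback (chartFlow Θ c) (s, z)) := by
  -- The bound depends only on `K` and the point, so the same segment serves a form and its exterior
  -- derivative.
  obtain ⟨R, hR, hev⟩ := hp.exists_bound hK ((extChartAt (𝓡 2) c).symm y)
  refine ⟨R, hR, hev.self_of_nhds, fun k α hα hαK => ?_⟩
  have hcont : ContinuousAt (extChartAt (𝓡 2) c).symm y := continuousAt_extChartAt_symm'' hy
  filter_upwards [hcont.eventually hev, (isOpen_extChartAt_target c).mem_nhds hy] with z hz hzt
  have h1 := pastForm_eq_intervalIntegral (α := α) hR fun s hs => hz s (hαK hs)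
  have h2 : (pastForm Θ α).chartRep c z = ContinuousAlternatingMap.compContinuousLinearMapCLM
      (show EuclideanSpace ℝ (Fin 2) →L[ℝ] EuclideanSpace ℝ (Fin 2) from
        mfderiv 𝓘(ℝ, EuclideanSpace ℝ (Fin 2)) (𝓡 2) (extChartAt (𝓡 2) c).symm z)
      (∫ s in (-R)..0, flowIntegrand Θ α ((extChartAt (𝓡 2) c).symm z) s) :=
    congrArg (ContinuousAlternatingMap.compContinuousLinearMap · _) h1
  rw [h2, ← ContinuousLinearMap.intervalIntegral_comp_comm
    (E := EuclideanSpace ℝ (Fin 2) [⋀^Fin k]→L[ℝ] ℝ)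
    (F := EuclideanSpace ℝ (Fin 2) [⋀^Fin k]→L[ℝ] ℝ) _
    ((continuous_flowIntegrand hΘ hα _).intervalIntegrable _ _)]
  exact intervalIntegral.integral_congr fun s _ => flowIntegrand_chart hΘ.contMDiff α c hzt s

lemma RawForm.IsSmooth.pastForm (hΘ : IsFlow Θ) (hp : IsProperFlow Θ) {k : ℕ}
    {α : RawForm N (k + 1)} (hα : α.IsSmooth) (hc : IsCompact α.supp) :
    (pastForm Θ α).IsSmooth := by
  intro c y hy
  obtain ⟨R, -, -, hev⟩ := exists_chartRep_pastForm_eq hΘ hp hc c hy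
  have hO := (isOpen_univ (X := ℝ)).prod (isOpen_extChartAt_target (I := 𝓡 2) c)
  have h1 := contDiffOn_parametric_intervalIntegral (isOpen_extChartAt_target c)
    ((fiberContraction _ k).contDiff.comp_contDiffOn
      (hα.contDiffOn_pullback hO (contMDiffOn_chartFlow hΘ.contMDiff c))) (-R) 0
  exact ((h1.contDiffAt ((isOpen_extChartAt_target c).mem_nhds hy)).congr_of_eventuallyEq
    (hev k α hα subset_rfl)).contDiffWithinAt

lemma fiberRestriction_pullback_zero (hΘ : IsFlow Θ) {k : ℕ} (α : RawForm N k) (c : N)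
    {y : EuclideanSpace ℝ (Fin 2)} (hy : y ∈ (extChartAt (𝓡 2) c).target) :
    fiberRestriction _ k (α.pullback (chartFlow Θ c) (0, y)) = α.chartRep c y := by
  have hO := (isOpen_univ (X := ℝ)).prod (isOpen_extChartAt_target (I := 𝓡 2) c)
  have h1 : HasMFDerivAt 𝓘(ℝ, ℝ × EuclideanSpace ℝ (Fin 2)) (𝓡 2) (chartFlow Θ c)
      ((0 : ℝ), y) (mfderiv 𝓘(ℝ, ℝ × EuclideanSpace ℝ (Fin 2)) (𝓡 2) (chartFlow Θ c) (0, y)) :=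
    (((contMDiffOn_chartFlow hΘ.contMDiff c).contMDiffAt
      (hO.mem_nhds ⟨mem_univ (0 : ℝ), hy⟩)).mdifferentiableAt (by simp)).hasMFDerivAt
  have h2 : HasMFDerivAt 𝓘(ℝ, EuclideanSpace ℝ (Fin 2)) 𝓘(ℝ, ℝ × EuclideanSpace ℝ (Fin 2))
      (fun z : EuclideanSpace ℝ (Fin 2) => ((0 : ℝ), z)) y
      (ContinuousLinearMap.inr ℝ ℝ (EuclideanSpace ℝ (Fin 2))) :=
    (hasFDerivAt_prodMk_right (0 : ℝ) y).hasMFDerivAt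
  have h3 := (h1.comp y h2).mfderiv
  have h4 : chartFlow Θ c ∘ (fun z : EuclideanSpace ℝ (Fin 2) => ((0 : ℝ), z)) =
      (extChartAt (𝓡 2) c).symm := funext fun z => hΘ.zero _
  -- Θ(0, x) and x are equal but not by definition; the values of α at both are compared on vectors
  -- of the common model space.
  have hpt : ∀ (x x' : N) (_ : x = x') (w : Fin k → EuclideanSpace ℝ (Fin 2)),
      (α x : EuclideanSpace ℝ (Fin 2) [⋀^Fin k]→L[ℝ] ℝ) w =
        (α x' : EuclideanSpace ℝ (Fin 2) [⋀^Fin k]→L[ℝ] ℝ) w := by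
    rintro x _ rfl w; rfl
  rw [h4] at h3
  ext v
  refine (hpt _ _ (hΘ.zero _) _).trans ?_
  refine congrArg (α ((extChartAt (𝓡 2) c).symm y) :
    EuclideanSpace ℝ (Fin 2) [⋀^Fin k]→L[ℝ] ℝ) (funext fun i => ?_)
  exact (DFunLike.congr_fun h3 (v i)).symm

/-- The operator `α ↦ ∫_{s ≤ 0} Θ^* α` is a homotopy between the identity and zero in positive
degrees. -/
lemma extd_pastForm_add (hΘ : IsFlow Θ) (hp : IsProperFlow Θ) {k : ℕ}
    {α : RawForm N (k + 1)} (hα : α.IsSmooth) (hc : IsCompact α.supp) :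
    (pastForm Θ α).extd + pastForm Θ α.extd = α := by
  refine RawForm.ext_chartRep fun c => ?_
  have hy := mem_extChartAt_target (I := 𝓡 2) c
  have hO := (isOpen_univ (X := ℝ)).prod (isOpen_extChartAt_target (I := 𝓡 2) c)
  have hF := contMDiffOn_chartFlow hΘ.contMDiff c
  obtain ⟨R, hR, hbd, hev⟩ := exists_chartRep_pastForm_eq hΘ hp hc c hy
  -- The bound |s| < R is strict, so at s = -R the flow line is outside supp α and the lower
  -- boundary term vanishes.
  have h0 : α.pullback (chartFlow Θ c) (-R, extChartAt (𝓡 2) c c) = 0 :=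
    pullback_chartFlow_eq_zero fun h => by simpa [abs_of_pos hR] using hbd _ h
  have h1 := extDeriv_intervalIntegral_fiberContraction (isOpen_extChartAt_target c)
    (hα.contDiffOn_pullback hO hF) (-R) 0 hy
  rw [fiberRestriction_pullback_zero hΘ α c hy, h0, map_zero, sub_zero,
    ← (hev k α hα subset_rfl).extDeriv_eq,
    ← RawForm.chartRep_extd (hα.pastForm hΘ hp hc) c hy] at h1
  rw [RawForm.chartRep_add, Pi.add_apply, ← h1,
    (hev (k + 1) α.extd hα.extd α.supp_extd_subset).self_of_nhds]
  congr 1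
  refine intervalIntegral.integral_congr fun s _ => ?_
  exact congrArg _ (hα.extDeriv_pullback hO hF ⟨mem_univ s, hy⟩).symm

/-- The fundamental theorem of calculus along a flow line, which is outside supp α at time -R. -/
lemma pastForm_extd_zero (hΘ : IsFlow Θ) (hp : IsProperFlow Θ)
    {α : RawForm N 0} (hα : α.IsSmooth) (hc : IsCompact α.supp) :
    pastForm Θ α.extd = α := by
  refine RawForm.ext_chartRep fun c => ?_
  have hy := mem_extChartAt_target (I := 𝓡 2) c
  have hO := (isOpen_univ (X := ℝ)).prod (isOpen_extChartAt_target (I := 𝓡 2) c)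
  have hF := contMDiffOn_chartFlow hΘ.contMDiff c
  obtain ⟨R, hR, hbd, hev⟩ := exists_chartRep_pastForm_eq hΘ hp hc c hy
  have h0 : α.pullback (chartFlow Θ c) (-R, extChartAt (𝓡 2) c c) = 0 :=
    pullback_chartFlow_eq_zero fun h => by simpa [abs_of_pos hR] using hbd _ h
  have h1 := intervalIntegral_fiberContraction_extDeriv_zero (isOpen_extChartAt_target c)
    (hα.contDiffOn_pullback hO hF) (-R) 0 hy
  rw [fiberRestriction_pullback_zero hΘ α c hy, h0, map_zero, sub_zero] at h1
  rw [← h1, (hev 0 α.extd hα.extd α.supp_extd_subset).self_of_nhds]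
  refine intervalIntegral.integral_congr fun s _ => ?_
  exact congrArg _ (hα.extDeriv_pullback hO hF ⟨mem_univ s, hy⟩).symm

end ProperFlow

/-! ### Null directions and self-duality -/

section Duality

variable {N : Type u} [TopologicalSpace N] [ChartedSpace (EuclideanSpace ℝ (Fin 2)) N]

lemma covector_apply {p : N} (α : TangentSpace (𝓡 2) p [⋀^Fin 1]→L[ℝ] ℝ)
    (v : TangentSpace (𝓡 2) p) : covector α v = α fun _ => v := by
  change α (Function.update 0 0 v) = _
  congr 1
  funext i
  rw [Subsingleton.elim i 0, Function.update_self]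

/-! ### Algebra of alternating 2-forms -/

section TwoForm

variable {V : Type*} [AddCommGroup V] [Module ℝ V] [TopologicalSpace V] (b : V [⋀^Fin 2]→L[ℝ] ℝ)

lemma ContinuousAlternatingMap.two_swap (x y : V) : b ![y, x] = -b ![x, y] := by
  have h := b.toAlternatingMap.map_swap ![x, y] (i := 0) (j := 1) (by simp)
  have h2 : (![x, y] ∘ Equiv.swap (0 : Fin 2) 1) = ![y, x] := by
    funext i
    fin_cases i <;> simp
  rw [h2] at h
  exact h

lemma ContinuousAlternatingMap.two_self (x : V) : b ![x, x] = 0 := by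
  have := b.two_swap x x
  linarith

lemma ContinuousAlternatingMap.two_comb_left (c d : ℝ) (x y v : V) :
    b ![c • x + d • y, v] = c * b ![x, v] + d * b ![y, v] := by
  have h1 := b.toMultilinearMap.cons_add ![v] (c • x) (d • y)
  have h2 := b.toMultilinearMap.cons_smul ![v] c x
  have h3 := b.toMultilinearMap.cons_smul ![v] d y
  exact h1.trans (congrArg₂ (· + ·) h2 h3)

lemma ContinuousAlternatingMap.two_comb (c d c' d' : ℝ) (x y : V) :
    b ![c • x + d • y, c' • x + d' • y] = (c * d' - d * c') * b ![x, y] := by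
  rw [b.two_comb_left, b.two_swap _ x, b.two_swap _ y, b.two_comb_left, b.two_comb_left,
    b.two_self, b.two_self, b.two_swap x y]
  ring

end TwoForm

variable [IsManifold (𝓡 2) ∞ N]

/-- The sign `ε` for which the forms with `* α = ε α` are those that vanish on the null vectors
pointing in a given direction. -/
def NullDirection.sign : NullDirection → ℝ
  | .ne => 1
  | .nw => -1
  | .sw => 1
  | .se => -1

/-- The opposite direction. -/
def NullDirection.opposite : NullDirection → NullDirection
  | .ne => .sw
  | .nw => .se
  | .sw => .ne
  | .se => .nw

namespace LorentzStructure

variable (S : LorentzStructure N)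

lemma frame_spec (p : N) : S.g p (S.frame p 0) (S.frame p 0) = -1 ∧
    S.g p (S.frame p 1) (S.frame p 1) = 1 ∧ S.g p (S.frame p 0) (S.frame p 1) = 0 :=
  (S.g_signature p).choose_spec

/-- Expansion in the orthonormal frame; the minus sign comes from the time-like frame vector, whose
square is -1. -/
lemma eq_frame_comb (p : N) (v : TangentSpace (𝓡 2) p) :
    v = (-S.g p v (S.frame p 0)) • S.frame p 0 + S.g p v (S.frame p 1) • S.frame p 1 := by
  obtain ⟨h00, h11, h01⟩ := S.frame_spec p
  have h10 : S.g p (S.frame p 1) (S.frame p 0) = 0 := by rw [S.g_symm, h01]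
  have hli : LinearIndependent ℝ (S.frame p) := by
    rw [Fintype.linearIndependent_iff]
    intro c hc
    rw [Fin.sum_univ_two] at hc
    have k0 : S.g p (c 0 • S.frame p 0 + c 1 • S.frame p 1) (S.frame p 0) = 0 := by
      rw [hc, map_zero]; rfl
    have k1 : S.g p (c 0 • S.frame p 0 + c 1 • S.frame p 1) (S.frame p 1) = 0 := by
      rw [hc, map_zero]; rfl
    simp [h00, h10] at k0
    simp [h11, h01] at k1
    intro i
    fin_cases i <;> assumption
  have hfr : Fintype.card (Fin 2) = Module.finrank ℝ (TangentSpace (𝓡 2) p) := by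
    change _ = Module.finrank ℝ (EuclideanSpace ℝ (Fin 2))
    simp
  let b := basisOfLinearIndependentOfCardEqFinrank hli hfr
  have hb : ∀ i, b i = S.frame p i := fun i => by simp [b]
  have hsum := b.sum_repr v
  rw [Fin.sum_univ_two, hb, hb] at hsum
  have k0 : S.g p v (S.frame p 0) = -(b.repr v 0) := by
    conv_lhs => rw [← hsum]
    simp [h00, h10]
  have k1 : S.g p v (S.frame p 1) = b.repr v 1 := by
    conv_lhs => rw [← hsum]
    simp [h11, h01]
  rw [k0, k1, neg_neg, hsum]

lemma orient_frame_ne_zero (p : N) : S.orient p (S.frame p) ≠ 0 := by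
  intro h
  refine S.orient_ne_zero p ?_
  ext w
  have hf : ![S.frame p 0, S.frame p 1] = S.frame p := by
    funext i
    fin_cases i <;> rfl
  have hw : w = ![w 0, w 1] := by
    funext i
    fin_cases i <;> rfl
  rw [hw, S.eq_frame_comb p (w 0), S.eq_frame_comb p (w 1), ContinuousAlternatingMap.two_comb,
    hf, h, mul_zero]
  rfl

/-- A covector is an eigenvector of the Hodge operator if and only if it vanishes on a null vector
of the corresponding direction. -/
lemma hodgeStar_eq_iff {dir : NullDirection} {p : N} {n : TangentSpace (𝓡 2) p}
    (hn : S.IsPointing dir p n) (β : TangentSpace (𝓡 2) p →L[ℝ] ℝ) :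
    S.hodgeStar p β = dir.sign • β ↔ β n = 0 := by
  obtain ⟨h00, h11, h01⟩ := S.frame_spec p
  have h10 : S.g p (S.frame p 1) (S.frame p 0) = 0 := by rw [S.g_symm, h01]
  obtain ⟨hn0, hnull, hdir⟩ := hn
  have hf : ![S.frame p 0, S.frame p 1] = S.frame p := by
    funext i
    fin_cases i <;> rfl
  have ho := S.orient_frame_ne_zero p
  have hvol : ∀ x y, S.vol p ![x, y] = |S.orient p (S.frame p)|⁻¹ * S.orient p ![x, y] :=
    fun _ _ => rfl
  have hu := S.eq_frame_comb p ((S.flat p).symm β)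
  have hflat : ∀ v, S.g p ((S.flat p).symm β) v = β v := fun v =>
    DFunLike.congr_fun ((S.flat p).apply_symm_apply β) v
  rw [hflat, hflat] at hu
  have hτ := S.eq_frame_comb p (S.time p)
  have hnn := S.eq_frame_comb p n
  set e₀ := S.frame p 0 with he₀
  set e₁ := S.frame p 1 with he₁
  set o := S.orient p (S.frame p) with ho_def
  set t₀ := -S.g p (S.time p) e₀
  set t₁ := S.g p (S.time p) e₁
  set n₀ := -S.g p n e₀
  set n₁ := S.g p n e₁
  have hgn : S.g p n n = -(n₀ * n₀) + n₁ * n₁ := by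
    rw [hnn]; simp [h00, h11, h01, h10]
  have hgt : S.g p (S.time p) n = -(t₀ * n₀) + t₁ * n₁ := by
    rw [hnn, hτ]; simp [h00, h11, h01, h10]
  have hot : S.orient p ![S.time p, n] = (t₀ * n₁ - t₁ * n₀) * o := by
    rw [hnn, hτ, ContinuousAlternatingMap.two_comb, hf]
  have hβn : β n = n₀ * β e₀ + n₁ * β e₁ := by
    rw [hnn]; simp
  have hsign : dir.sign = 1 ∨ dir.sign = -1 := by
    cases dir <;> simp [NullDirection.sign]
  -- The product of the two defining signs is negative for ↗ and ↙ and positive for ↖ and ↘. It is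
  -- all that duality sees of the direction.
  have hneg : dir.sign * (S.orient p ![S.time p, n] * S.g p (S.time p) n) < 0 := by
    cases dir <;> simp only [NullDirection.sign, one_mul, neg_mul, neg_lt_zero]
    · exact mul_neg_of_pos_of_neg hdir.2 hdir.1
    · exact mul_pos_of_neg_of_neg hdir.2 hdir.1
    · exact mul_neg_of_neg_of_pos hdir.2 hdir.1
    · exact mul_pos hdir.2 hdir.1
  have hn₀ : n₀ ≠ 0 := by
    intro h
    have h1 : n₁ = 0 := by
      rw [hnull, h] at hgn
      simpa using hgn.symm
    exact hn0 (by rw [hnn, h, h1, zero_smul, zero_smul, add_zero])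
  obtain ⟨r, hr, hrn⟩ : ∃ r : ℝ, (r = 1 ∨ r = -1) ∧ n₁ = r * n₀ := by
    rw [hnull] at hgn
    rcases mul_self_eq_mul_self_iff.1 (show n₁ * n₁ = n₀ * n₀ by linarith) with h | h
    · exact ⟨1, Or.inl rfl, by rw [h, one_mul]⟩
    · exact ⟨-1, Or.inr rfl, by rw [h, neg_one_mul]⟩
  rw [hot, hgt, hrn] at hneg
  -- With n₁ = r n₀, the product in `hneg` is -r o times the square of (t₀ - r t₁) n₀.
  have hpos : 0 < dir.sign * r * o := by
    rcases hr with rfl | rfl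
    · by_contra hle
      have : 0 ≤ -(dir.sign * 1 * o) * ((t₀ - t₁) * n₀) ^ 2 :=
        mul_nonneg (by linarith) (sq_nonneg _)
      nlinarith
    · by_contra hle
      have : 0 ≤ -(dir.sign * (-1) * o) * ((t₀ + t₁) * n₀) ^ 2 :=
        mul_nonneg (by linarith) (sq_nonneg _)
      nlinarith
  -- This is the value of the volume form on the chosen frame, that is, the orientation sign of the
  -- frame.
  have hk : |o|⁻¹ * o = dir.sign * r := by
    have habs : |o| = dir.sign * r * o := by
      rw [← abs_of_pos hpos, abs_mul, abs_mul]
      rcases hsign with h | h <;> rcases hr with h' | h' <;> simp [h, h']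
    rw [inv_mul_eq_iff_eq_mul₀ (abs_ne_zero.2 ho), habs]
    rcases hsign with h | h <;> rcases hr with h' | h' <;> simp [h, h']
  have hs0 : S.hodgeStar p β e₀ = -(β e₁ * (dir.sign * r)) := by
    rw [hodgeStar_apply, hvol, hu, ContinuousAlternatingMap.two_comb_left,
      ContinuousAlternatingMap.two_self, ContinuousAlternatingMap.two_swap, hf, ← hk]
    ring
  have hs1 : S.hodgeStar p β e₁ = -(β e₀ * (dir.sign * r)) := by
    rw [hodgeStar_apply, hvol, hu, ContinuousAlternatingMap.two_comb_left,
      ContinuousAlternatingMap.two_self, hf, ← hk]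
    ring
  have hiff : S.hodgeStar p β = dir.sign • β ↔
      S.hodgeStar p β e₀ = dir.sign * β e₀ ∧ S.hodgeStar p β e₁ = dir.sign * β e₁ := by
    refine ⟨fun h => by rw [h]; exact ⟨rfl, rfl⟩, fun h => ?_⟩
    ext v
    rw [S.eq_frame_comb p v, ← he₀, ← he₁, map_add, map_add, map_smul, map_smul, map_smul,
      map_smul, h.1, h.2]
    rfl
  have hβr : β n = n₀ * (β e₀ + r * β e₁) := by rw [hβn, hrn]; ring
  -- Since r² = 1, each of the two frame equations says β e₀ + r β e₁ = 0, which is β n = 0 up to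
  -- the factor n₀ ≠ 0.
  rw [hiff, hs0, hs1, hβr, mul_eq_zero, or_iff_right hn₀]
  rcases hsign with h | h <;> rcases hr with h' | h' <;> rw [h, h'] <;>
    constructor <;> intro hh <;> first | (constructor <;> linarith) | linarith [hh.1]

lemma mem_dualForms_iff {dir : NullDirection} {n : ∀ p : N, TangentSpace (𝓡 2) p}
    (hn : ∀ p, S.IsPointing dir p (n p)) (α : RawForm N 1) :
    α ∈ S.dualForms dir.sign ↔ α.IsSmooth ∧ ∀ p, α p (fun _ => n p) = 0 := by
  refine and_congr_right fun _ => forall_congr' fun p => ?_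
  rw [S.hodgeStar_eq_iff (hn p), covector_apply]

lemma IsPointing.pos_smul {S : LorentzStructure N} {dir : NullDirection} {p : N}
    {v : TangentSpace (𝓡 2) p} (hv : S.IsPointing dir p v) {a : ℝ} (ha : 0 < a) :
    S.IsPointing dir p (a • v) := by
  have ho : S.orient p ![S.time p, a • v] = a * S.orient p ![S.time p, v] := by
    rw [ContinuousAlternatingMap.two_swap, ContinuousAlternatingMap.two_swap _ v]
    have := (S.orient p).toMultilinearMap.cons_smul ![S.time p] a v
    exact (congrArg Neg.neg this).trans (by simp)
  refine ⟨smul_ne_zero ha.ne' hv.1, by simp [hv.2.1], ?_⟩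
  have h := hv.2.2
  cases dir <;> simp only [ho, map_smul, smul_eq_mul, mul_neg_iff, mul_pos_iff] at h ⊢ <;>
    simp [ha, h, ha.le, not_lt.2]

lemma IsPointing.neg {S : LorentzStructure N} {dir : NullDirection} {p : N}
    {v : TangentSpace (𝓡 2) p} (hv : S.IsPointing dir p v) :
    S.IsPointing dir.opposite p (-v) := by
  have ho : S.orient p ![S.time p, -v] = -S.orient p ![S.time p, v] := by
    rw [ContinuousAlternatingMap.two_swap, ContinuousAlternatingMap.two_swap _ v]
    have := (S.orient p).toMultilinearMap.cons_smul ![S.time p] (-1) v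
    rw [neg_one_smul, neg_one_smul] at this
    exact congrArg Neg.neg this
  refine ⟨neg_ne_zero.2 hv.1, by simp [hv.2.1], ?_⟩
  have h := hv.2.2
  cases dir <;> simpa [NullDirection.opposite, ho] using h

end LorentzStructure

end Duality

/-! ### Flows along null directions -/

section NullFlow

variable {N : Type u} [TopologicalSpace N] {Θ : ℝ × N → N}

/-- The flow run backwards in time. -/
def reversedFlow (Θ : ℝ × N → N) (x : ℝ × N) : N := Θ (-x.1, x.2)

lemma IsProperFlow.reversed (hp : IsProperFlow Θ) : IsProperFlow (reversedFlow Θ) :=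
  IsProperMap.comp hp ((Homeomorph.neg ℝ).prodCongr (Homeomorph.refl N)).isProperMap

variable [ChartedSpace (EuclideanSpace ℝ (Fin 2)) N]

lemma IsFlow.reversed (hΘ : IsFlow Θ) : IsFlow (reversedFlow Θ) where
  contMDiff := hΘ.contMDiff.comp (((contDiff_neg.contMDiff).comp contMDiff_fst).prodMk
    contMDiff_snd)
  zero p := by rw [reversedFlow, neg_zero, hΘ.zero]
  add s t p := by simp only [reversedFlow]; rw [neg_add, hΘ.add]

lemma mfderiv_reversedFlow (hΘ : IsFlow Θ) (s : ℝ) (p : N) (a : ℝ)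
    (v : EuclideanSpace ℝ (Fin 2)) :
    mfderiv (𝓘(ℝ, ℝ).prod (𝓡 2)) (𝓡 2) (reversedFlow Θ) (s, p) (a, v) =
      mfderiv (𝓘(ℝ, ℝ).prod (𝓡 2)) (𝓡 2) Θ (-s, p) (-a, v) := by
  have h1 : HasMFDerivAt (𝓘(ℝ, ℝ).prod (𝓡 2)) 𝓘(ℝ, ℝ) (Prod.fst : ℝ × N → ℝ) (s, p)
      (ContinuousLinearMap.fst ℝ ℝ (EuclideanSpace ℝ (Fin 2))) := hasMFDerivAt_fst (s, p)
  have h2 : HasMFDerivAt (𝓘(ℝ, ℝ).prod (𝓡 2)) (𝓡 2) (Prod.snd : ℝ × N → N) (s, p)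
      (ContinuousLinearMap.snd ℝ ℝ (EuclideanSpace ℝ (Fin 2))) := hasMFDerivAt_snd (s, p)
  have h3 : HasMFDerivAt 𝓘(ℝ, ℝ) 𝓘(ℝ, ℝ) (fun s : ℝ => -s) s (-ContinuousLinearMap.id ℝ ℝ) :=
    (hasFDerivAt_id s).neg.hasMFDerivAt
  have h4 : HasMFDerivAt (𝓘(ℝ, ℝ).prod (𝓡 2)) (𝓡 2) Θ (-s, p)
      (mfderiv (𝓘(ℝ, ℝ).prod (𝓡 2)) (𝓡 2) Θ (-s, p)) :=
    (hΘ.contMDiff.mdifferentiable (by simp) _).hasMFDerivAt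
  have h5 := h4.comp (s, p) ((h3.comp (s, p) h1).prodMk h2)
  exact DFunLike.congr_fun h5.mfderiv (a, v)

/-- Time reversal negates the vector in the first slot, which gives the sign of the backward
operator, and s ↦ -s exchanges the half-lines. Backward statements thus reduce to forward ones. -/
lemma forwardG_reversedFlow (hΘ : IsFlow Θ) {k : ℕ} (α : RawForm N (k + 1)) (p : N)
    (v : Fin k → TangentSpace (𝓡 2) p) :
    forwardG (reversedFlow Θ) α p v = backwardG Θ α p v := by
  have h : ∀ s, flowIntegrand (reversedFlow Θ) α p s v = -flowIntegrand Θ α p (-s) v := by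
    intro s
    let w : Fin k → EuclideanSpace ℝ (Fin 2) := fun i =>
      mfderiv (𝓘(ℝ, ℝ).prod (𝓡 2)) (𝓡 2) Θ (-s, p) ((0 : ℝ), v i)
    let u : EuclideanSpace ℝ (Fin 2) :=
      mfderiv (𝓘(ℝ, ℝ).prod (𝓡 2)) (𝓡 2) Θ (-s, p) ((1 : ℝ), (0 : EuclideanSpace ℝ (Fin 2)))
    let A : EuclideanSpace ℝ (Fin 2) [⋀^Fin (k + 1)]→L[ℝ] ℝ := α (Θ (-s, p))
    have h1 : flowIntegrand (reversedFlow Θ) α p s v = A (Fin.cons (-u) w) := by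
      refine congrArg A (funext fun i => ?_)
      refine Fin.cases ?_ (fun i => ?_) i
      · refine (mfderiv_reversedFlow hΘ s p 1 0).trans ?_
        have h2 : ((-1 : ℝ), (0 : EuclideanSpace ℝ (Fin 2))) =
          -((1 : ℝ), (0 : EuclideanSpace ℝ (Fin 2))) := by simp
        exact (congrArg (mfderiv (𝓘(ℝ, ℝ).prod (𝓡 2)) (𝓡 2) Θ (-s, p)) h2).trans
          (map_neg (mfderiv (𝓘(ℝ, ℝ).prod (𝓡 2)) (𝓡 2) Θ (-s, p)) _)
      · refine (mfderiv_reversedFlow hΘ s p 0 (v i)).trans ?_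
        exact congrArg (fun a : ℝ => mfderiv (𝓘(ℝ, ℝ).prod (𝓡 2)) (𝓡 2) Θ (-s, p) (a, v i))
          neg_zero
    have h3 : flowIntegrand Θ α p (-s) v = A (Fin.cons u w) := by
      refine congrArg A (funext fun i => ?_)
      exact Fin.cases rfl (fun i => rfl) i
    have h4 := A.toMultilinearMap.cons_smul w (-1) u
    rw [neg_one_smul, neg_one_smul] at h4
    rw [h1, h3]
    exact h4
  have h1 : forwardG (reversedFlow Θ) α p v =
      ∫ s in Iic (0 : ℝ), -flowIntegrand Θ α p (-s) v :=
    integral_congr_ae (Filter.Eventually.of_forall h)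
  rw [h1, integral_neg, integral_comp_neg_Iic 0 fun s => flowIntegrand Θ α p s v, neg_zero,
    ← integral_Ici_eq_integral_Ioi]
  rfl

variable {n : ∀ p : N, TangentSpace (𝓡 2) p}

lemma mfderiv_flow_time (hΘ : IsFlow Θ) (hn : ∀ p, IsMIntegralCurve (fun s => Θ (s, p)) n)
    (s : ℝ) (p : N) :
    mfderiv (𝓘(ℝ, ℝ).prod (𝓡 2)) (𝓡 2) Θ (s, p) ((1 : ℝ), (0 : EuclideanSpace ℝ (Fin 2))) =
      n (Θ (s, p)) := by
  have h1 : HasMFDerivAt 𝓘(ℝ, ℝ) (𝓡 2) (fun _ : ℝ => p) s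
      (0 : ℝ →L[ℝ] EuclideanSpace ℝ (Fin 2)) := hasMFDerivAt_const p s
  have h4 : HasMFDerivAt (𝓘(ℝ, ℝ).prod (𝓡 2)) (𝓡 2) Θ (s, p)
      (mfderiv (𝓘(ℝ, ℝ).prod (𝓡 2)) (𝓡 2) Θ (s, p)) :=
    (hΘ.contMDiff.mdifferentiable (by simp) _).hasMFDerivAt
  have h5 := h4.comp s ((hasMFDerivAt_id (I := 𝓘(ℝ, ℝ)) s).prodMk h1)
  have h6 := DFunLike.congr_fun (hasMFDerivAt_unique h5 (hn p s)) (1 : ℝ)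
  refine h6.trans ?_
  exact one_smul ℝ (show EuclideanSpace ℝ (Fin 2) from n (Θ (s, p)))

/-- A flow preserves its generator. -/
lemma mfderiv_flow_generator (hΘ : IsFlow Θ) (hn : ∀ p, IsMIntegralCurve (fun s => Θ (s, p)) n)
    (s : ℝ) (p : N) :
    mfderiv (𝓘(ℝ, ℝ).prod (𝓡 2)) (𝓡 2) Θ (s, p) ((0 : ℝ), n p) = n (Θ (s, p)) := by
  -- Differentiate Θ(s, Θ(t, p)) = Θ(s + t, p) at t = 0. The base points Θ(0, p) and s + 0 are kept
  -- unsimplified so that the derivatives on both sides typecheck.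
  have key : ∀ q, Θ (0, p) = q →
      (show EuclideanSpace ℝ (Fin 2) from
        mfderiv (𝓘(ℝ, ℝ).prod (𝓡 2)) (𝓡 2) Θ (s, q) ((0 : ℝ), n q)) =
      (show EuclideanSpace ℝ (Fin 2) from n (Θ (s + 0, p))) := by
    rintro q rfl
    have h1 : HasMFDerivAt 𝓘(ℝ, ℝ) 𝓘(ℝ, ℝ) (fun _ : ℝ => s) 0 (0 : ℝ →L[ℝ] ℝ) :=
      hasMFDerivAt_const s 0
    have h4 : HasMFDerivAt (𝓘(ℝ, ℝ).prod (𝓡 2)) (𝓡 2) Θ (s, Θ (0, p))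
        (mfderiv (𝓘(ℝ, ℝ).prod (𝓡 2)) (𝓡 2) Θ (s, Θ (0, p))) :=
      (hΘ.contMDiff.mdifferentiable (by simp) _).hasMFDerivAt
    have h5 := h4.comp (0 : ℝ) (h1.prodMk (hn p 0))
    have h7 : HasMFDerivAt 𝓘(ℝ, ℝ) 𝓘(ℝ, ℝ) (fun t : ℝ => s + t) 0
        (ContinuousLinearMap.id ℝ ℝ) := ((hasFDerivAt_id (0 : ℝ)).const_add s).hasMFDerivAt
    have h8 := (hn p (s + 0)).comp (0 : ℝ) h7
    have h9 := h8.congr_of_eventuallyEq (f₁ := Θ ∘ fun t : ℝ => (s, Θ (t, p)))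
      (Filter.Eventually.of_forall fun t => (hΘ.add s t p).symm)
    have h10 := DFunLike.congr_fun (hasMFDerivAt_unique h5 h9) (1 : ℝ)
    have h11 : ∀ w : EuclideanSpace ℝ (Fin 2), (1 : ℝ) • w = w := one_smul ℝ
    refine Eq.trans ?_ (h10.trans (h11 _))
    exact (congrArg (fun w : EuclideanSpace ℝ (Fin 2) => mfderiv (𝓘(ℝ, ℝ).prod (𝓡 2)) (𝓡 2) Θ
      (s, Θ (0, p)) ((0 : ℝ), w)) (h11 _)).symm
  refine (key p (hΘ.zero p)).trans ?_
  rw [add_zero]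

lemma flowIntegrand_eq_generator (hΘ : IsFlow Θ)
    (hn : ∀ p, IsMIntegralCurve (fun s => Θ (s, p)) n) {k : ℕ} (α : RawForm N (k + 1)) (p : N)
    (s : ℝ) (v : Fin k → EuclideanSpace ℝ (Fin 2)) :
    flowIntegrand Θ α p s v = α (Θ (s, p)) (Fin.cons (n (Θ (s, p))) fun i =>
      mfderiv (𝓘(ℝ, ℝ).prod (𝓡 2)) (𝓡 2) Θ (s, p) ((0 : ℝ), v i)) := by
  refine congrArg (α (Θ (s, p))) (funext fun i => ?_)
  exact Fin.cases (mfderiv_flow_time hΘ hn s p) (fun i => rfl) i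

/-- The integrand is α(n) along the flow line. The subcomplexes contain no functions, so 1-forms
must be sent to zero. -/
lemma pastForm_eq_zero_of_generator (hΘ : IsFlow Θ)
    (hn : ∀ p, IsMIntegralCurve (fun s => Θ (s, p)) n) {α : RawForm N 1}
    (hα : ∀ p, α p (fun _ => n p) = 0) : pastForm Θ α = 0 := by
  funext p
  have h : ∀ s, flowIntegrand Θ α p s = 0 := by
    intro s
    ext v
    rw [flowIntegrand_eq_generator hΘ hn]
    refine Eq.trans (congrArg (α (Θ (s, p))) (funext fun i => ?_)) (hα (Θ (s, p)))
    exact Fin.cases rfl (fun j => j.elim0) i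
  exact (integral_congr_ae (Filter.Eventually.of_forall h)).trans (integral_zero _ _)

/-- The flow carries both ∂_s and n to n, so the integrand is α(n, n) = 0. This sends 2-forms to
(anti-)self-dual 1-forms. -/
lemma pastForm_generator (hΘ : IsFlow Θ) (hp : IsProperFlow Θ) [IsManifold (𝓡 2) ∞ N]
    (hn : ∀ p, IsMIntegralCurve (fun s => Θ (s, p)) n) {α : RawForm N 2} (hα : α.IsSmooth)
    (hc : IsCompact α.supp) (p : N) : pastForm Θ α p (fun _ => n p) = 0 := by
  rw [pastForm_apply hΘ hp hα hc]
  have h : ∀ s, flowIntegrand Θ α p s (fun _ => n p) = 0 := by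
    intro s
    refine (flowIntegrand_eq_generator hΘ hn α p s _).trans ?_
    refine (α (Θ (s, p))).map_eq_zero_of_eq _ (i := 0) (j := 1) ?_ (by simp)
    exact (mfderiv_flow_generator hΘ hn s p).symm
  exact (integral_congr_ae (Filter.Eventually.of_forall h)).trans (integral_zero _ _)

variable [IsManifold (𝓡 2) ∞ N] {S : LorentzStructure N} {dir : NullDirection}

lemma LorentzStructure.IsChiralFlow.reversed (h : S.IsChiralFlow dir Θ) :
    S.IsChiralFlow dir.opposite (reversedFlow Θ) := by
  obtain ⟨hΘ, n, hns, hn, hint⟩ := h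
  refine ⟨hΘ.reversed, -n, hns.neg_section, fun p => (hn p).neg, fun p => ?_⟩
  have h1 := (hint p).comp_mul (-1)
  rw [neg_one_smul] at h1
  have h2 : (fun s => reversedFlow Θ (s, p)) = (fun s => Θ (s, p)) ∘ (· * (-1 : ℝ)) := by
    funext s
    simp [reversedFlow]
  rw [h2]
  exact h1

/-- The points whose past meets `K` can be reached from `K` along null curves. -/
lemma LorentzStructure.IsChiralFlow.future_subset_J (h : S.IsChiralFlow dir Θ) (K : Set N) :
    {q | ∃ s ≤ 0, Θ (s, q) ∈ K} ⊆ S.J dir K := by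
  obtain ⟨hΘ, n, hns, hn, hint⟩ := h
  rintro q ⟨s, hs, hK⟩
  refine ⟨Θ (s, q), hK, ?_⟩
  rcases hs.eq_or_lt with rfl | hs
  · exact Or.inl (hΘ.zero q).symm
  -- The flow line from Θ(s, q) to q, rescaled from [0, -s] to [0, 1]. Its velocity is -s > 0 times
  -- the generator; s = 0 was split off because the velocity would vanish.
  refine Or.inr ⟨(fun t => Θ (t, Θ (s, q))) ∘ (· * (-s)), ⟨?_, fun t ht => ?_⟩, ?_, ?_⟩
  · refine (hΘ.contMDiff.comp (ContMDiff.prodMk ?_ contMDiff_const)).contMDiffOn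
    exact (contDiff_id.mul contDiff_const).contMDiff
  · have h1 := ((hint (Θ (s, q))).comp_mul (-s) t).hasMFDerivWithinAt (s := Icc (0 : ℝ) 1)
    have h2 : UniqueMDiffWithinAt 𝓘(ℝ, ℝ) (Icc (0 : ℝ) 1) t :=
      (uniqueDiffOn_Icc zero_lt_one t ht).uniqueMDiffWithinAt
    rw [h1.mfderivWithin h2]
    have h3 : ∀ w : EuclideanSpace ℝ (Fin 2), (1 : ℝ) • w = w := one_smul ℝ
    refine (congrArg (S.IsPointing dir _) (h3 _)).mpr ?_
    exact (hn _).pos_smul (neg_pos.2 hs)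
  · simp [hΘ.zero]
  · simp only [Function.comp_apply, one_mul]
    rw [← hΘ.add, neg_add_cancel, hΘ.zero]

end NullFlow

/-! ### Operators of degree `-1` on complexes of forms -/

section Cochains

variable {N : Type u} [TopologicalSpace N] [ChartedSpace (EuclideanSpace ℝ (Fin 2)) N]
  [IsManifold (𝓡 2) ∞ N] {A B : DeRhamSubcomplex N}

namespace DeRhamSubcomplex

lemma form_mem (A : DeRhamSubcomplex N) {p : ℤ} (x : A.shifted.X p) (k : ℕ)
    (hk : (k : ℤ) = p + 1) : A.form x k hk ∈ A.carrier k :=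
  ((show A.degree (p + 1) from x) ⟨k, hk⟩).2

lemma ext_form {p : ℤ} {x y : A.shifted.X p}
    (h : ∀ (k : ℕ) (hk : (k : ℤ) = p + 1), A.form x k hk = A.form y k hk) : x = y :=
  funext (f := (show A.degree (p + 1) from x)) (g := (show A.degree (p + 1) from y))
    fun k => Subtype.ext (h k.1 k.2)

/-- The cochain of degree `-1` on shifted complexes given by operators that lower the form
degree. -/
def loweringCochain (P : ∀ k, A.carrier (k + 1) →ₗ[ℝ] B.carrier k) :
    Cochain A.shifted B.shifted (-1) :=
  Cochain.mk fun p q h => ModuleCat.ofHom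
    (show A.degree (p + 1) →ₗ[ℝ] B.degree (q + 1) from
      LinearMap.pi fun k => (P k.1).comp (LinearMap.proj
        (R := ℝ) (φ := fun k : {k : ℕ // (k : ℤ) = p + 1} => A.carrier k) ⟨k.1 + 1, by
          have := k.2
          push_cast
          lia⟩))

lemma form_loweringCochain (P : ∀ k, A.carrier (k + 1) →ₗ[ℝ] B.carrier k) (p q : ℤ)
    (h : p + -1 = q) (x : A.shifted.X p) (k : ℕ) (hk : (k : ℤ) = q + 1)
    (hk' : ((k + 1 : ℕ) : ℤ) = p + 1) :
    B.form (((loweringCochain P).v p q h).hom x) k hk =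
      (P k ⟨A.form x (k + 1) hk', A.form_mem x (k + 1) hk'⟩).1 := rfl

lemma toComplex_d_apply (A : DeRhamSubcomplex N) (m : ℤ) (x : A.degree m) :
    (show A.degree (m + 1) from (A.toComplex.d m (m + 1)).hom x) = A.dInt m x := by
  simp only [DeRhamSubcomplex.toComplex, CochainComplex.of_d]
  rfl

lemma shifted_d_apply (A : DeRhamSubcomplex N) (p : ℤ) (x : A.shifted.X p) :
    (show A.degree (p + 1 + 1) from (A.shifted.d p (p + 1)).hom x) =
      -A.dInt (p + 1) (show A.degree (p + 1) from x) := by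
  rw [← toComplex_d_apply]
  have h1 : A.shifted.d p (p + 1) = -A.toComplex.d (p + 1) (p + 1 + 1) := by
    rw [CochainComplex.shiftFunctor_obj_d']
    simp
  rw [h1]
  rfl

lemma form_d_succ {p q : ℤ} (h : p + 1 = q) (x : A.shifted.X p) (k : ℕ)
    (hk : ((k + 1 : ℕ) : ℤ) = q + 1) (hk' : (k : ℤ) = p + 1) :
    A.form ((A.shifted.d p q).hom x) (k + 1) hk = -(A.form x k hk').extd := by
  subst h
  exact congrArg Subtype.val (congrFun (A.shifted_d_apply p x) ⟨k + 1, hk⟩)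

lemma form_d_zero {p q : ℤ} (h : p + 1 = q) (x : A.shifted.X p)
    (hk : ((0 : ℕ) : ℤ) = q + 1) :
    A.form ((A.shifted.d p q).hom x) 0 hk = 0 := by
  subst h
  exact (congrArg Subtype.val (congrFun (A.shifted_d_apply p x) ⟨0, hk⟩)).trans neg_zero

lemma loweringCochain_d_apply (P : ∀ k, A.carrier (k + 1) →ₗ[ℝ] B.carrier k) {p q : ℤ}
    (h : p + 1 = q) (h' : q + -1 = p) (x : A.shifted.X p) (k : ℕ) (hk : (k : ℤ) = p + 1) :
    B.form (((loweringCochain P).v q p h').hom ((A.shifted.d p q).hom x)) k hk =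
      -(P k (A.d k ⟨A.form x k hk, A.form_mem x k hk⟩)).1 := by
  have hk' : ((k + 1 : ℕ) : ℤ) = q + 1 := by
    push_cast
    lia
  rw [form_loweringCochain P q p h' _ k hk hk']
  have h1 : (⟨A.form ((A.shifted.d p q).hom x) (k + 1) hk', A.form_mem _ _ hk'⟩ :
      A.carrier (k + 1)) = -A.d k ⟨A.form x k hk, A.form_mem x k hk⟩ :=
    Subtype.ext (form_d_succ h x k hk' hk)
  rw [h1]
  have h2 : P k (-A.d k ⟨A.form x k hk, A.form_mem x k hk⟩) =
      -P k (A.d k ⟨A.form x k hk, A.form_mem x k hk⟩) := map_neg (P k) _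
  exact congrArg Subtype.val h2

/-- The differential of the cochain given by lowering operators. -/
lemma form_δ_loweringCochain (P : ∀ k, A.carrier (k + 1) →ₗ[ℝ] B.carrier k) (p : ℤ)
    (x : A.shifted.X p) (k : ℕ) (hk : (k : ℤ) = p + 1) :
    B.form (((δ (-1) 0 (loweringCochain P)).v p p (add_zero p)).hom x) k hk =
      B.form ((B.shifted.d (p - 1) p).hom (((loweringCochain P).v p (p - 1) rfl).hom x)) k hk -
      (P k (A.d k ⟨A.form x k hk, A.form_mem x k hk⟩)).1 := by
  rw [δ_v (-1) 0 (by norm_num) _ p p (add_zero p) (p - 1) (p + 1) rfl rfl,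
    Int.negOnePow_zero, one_smul]
  refine Eq.trans ?_ (sub_eq_add_neg _ _).symm
  exact congrArg (B.form ((B.shifted.d (p - 1) p).hom
    (((loweringCochain P).v p (p - 1) rfl).hom x)) k hk + ·)
    (loweringCochain_d_apply P rfl (by lia) x k hk)

/-- The differential of the shifted complex is -d, so both terms of `δ` acquire a minus sign. Hence
the boundary is the inclusion when dP + Pd = -id, with the first term missing on functions. -/
lemma δ_loweringCochain (P : ∀ k, A.compact.carrier (k + 1) →ₗ[ℝ] A.carrier k)
    (h0 : ∀ α : A.compact.carrier 0, (P 0 (A.compact.d 0 α)).1 = -α.1)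
    (hs : ∀ k (α : A.compact.carrier (k + 1)),
      (P k α).1.extd + (P (k + 1) (A.compact.d (k + 1) α)).1 = -α.1) :
    δ (-1) 0 (loweringCochain P) =
      Cochain.ofHom ((incl (A := A.compact) (B := A) fun _ => inf_le_left)⟦(1 : ℤ)⟧') := by
  refine Cochain.ext₀ _ _ fun p =>
    ModuleCat.hom_ext (LinearMap.ext fun x => ext_form fun k hk => ?_)
  rw [form_δ_loweringCochain]
  have hr : A.form (((Cochain.ofHom ((incl (A := A.compact) (B := A)
      fun _ => inf_le_left)⟦(1 : ℤ)⟧')).v p p (add_zero p)).hom x) k hk =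
      A.compact.form x k hk := by
    rw [Cochain.ofHom_v]
    rfl
  rw [hr]
  match k, hk with
  | 0, hk =>
    rw [form_d_zero (by lia), h0, sub_neg_eq_add, zero_add]
  | k + 1, hk =>
    have hk' : (k : ℤ) = p - 1 + 1 := by
      push_cast at hk
      lia
    rw [form_d_succ (by lia) _ k hk hk', form_loweringCochain P p (p - 1) rfl x k hk' hk,
      ← neg_add', hs, neg_neg]

lemma supp_eq (A : DeRhamSubcomplex N) {p : ℤ} (x : A.shifted.X p) (k : ℕ)
    (hk : (k : ℤ) = p + 1) : A.supp x = (A.form x k hk).supp := by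
  refine congrArg closure (Set.ext fun q => ⟨?_, fun h => ⟨k, hk, h⟩⟩)
  rintro ⟨k', hk', h⟩
  obtain rfl : k' = k := by lia
  exact h

variable {Θ : ℝ × N → N}

/-- The operators `α ↦ -∫_{s ≤ 0} Θ^* α` on a subcomplex. -/
def pastOperator (hΘ : IsFlow Θ) (hp : IsProperFlow Θ)
    (hA : ∀ k, ∀ α ∈ A.compact.carrier (k + 1), pastForm Θ α ∈ A.carrier k) (k : ℕ) :
    A.compact.carrier (k + 1) →ₗ[ℝ] A.carrier k where
  toFun α := ⟨-pastForm Θ α.1, neg_mem (hA k α.1 α.2)⟩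
  map_add' α β := Subtype.ext (by
    change -pastForm Θ (α.1 + β.1) = -pastForm Θ α.1 + -pastForm Θ β.1
    rw [pastForm_add hΘ hp (A.smooth α.2.1) α.2.2 (A.smooth β.2.1) β.2.2, neg_add])
  map_smul' a α := Subtype.ext (by
    change -pastForm Θ (a • α.1) = a • -pastForm Θ α.1
    rw [pastForm_smul, smul_neg])

variable (hΘ : IsFlow Θ) (hp : IsProperFlow Θ)
  (hA : ∀ k, ∀ α ∈ A.compact.carrier (k + 1), pastForm Θ α ∈ A.carrier k)

lemma isGreensHomotopy_pastOperator [T2Space N] {J : Set N → Set N}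
    (hJ : ∀ K, {q | ∃ s ≤ 0, Θ (s, q) ∈ K} ⊆ J K) :
    IsGreensHomotopy A J (loweringCochain (pastOperator hΘ hp hA)) where
  boundary := by
    refine δ_loweringCochain _ (fun α => ?_) fun k α => ?_
    · exact congrArg Neg.neg (pastForm_extd_zero hΘ hp (A.smooth α.2.1) α.2.2)
    · have h1 := (pastForm Θ α.1).extd_neg
      have h2 := extd_pastForm_add hΘ hp (A.smooth α.2.1) α.2.2
      change (-pastForm Θ α.1).extd + -pastForm Θ α.1.extd = -α.1
      rw [h1, ← neg_add, h2]
  supp_subset p q h x := by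
    -- If q + 1 is negative, the target is trivial and the support is empty.
    by_cases hq : ∃ k : ℕ, (k : ℤ) = q + 1
    · obtain ⟨k, hk⟩ := hq
      have hk' : ((k + 1 : ℕ) : ℤ) = p + 1 := by
        push_cast
        lia
      rw [A.supp_eq _ k hk, A.compact.supp_eq x (k + 1) hk',
        form_loweringCochain _ p q h x k hk hk']
      have hmem := A.compact.form_mem x (k + 1) hk'
      have h1 : RawForm.supp (-pastForm Θ (A.compact.form x (k + 1) hk')) =
          (pastForm Θ (A.compact.form x (k + 1) hk')).supp := by
        simp only [RawForm.supp, Pi.neg_apply, ne_eq, neg_eq_zero]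
      change RawForm.supp (-pastForm Θ (A.compact.form x (k + 1) hk')) ⊆ _
      rw [h1]
      exact (supp_pastForm_subset hp hΘ hmem.2).trans (hJ _)
    · have h1 : A.supp (((loweringCochain (pastOperator hΘ hp hA)).v p q h).hom x) = ∅ := by
        refine (closure_empty_iff _).2 (Set.eq_empty_of_forall_notMem ?_)
        rintro r ⟨k, hk, -⟩
        exact hq ⟨k, hk⟩
      rw [h1]
      exact empty_subset _

lemma pastForm_mem_deRham (hΘ : IsFlow Θ) (hp : IsProperFlow Θ) (k : ℕ) (α : RawForm N (k + 1))
    (hα : α ∈ (deRham N).compact.carrier (k + 1)) : pastForm Θ α ∈ (deRham N).carrier k :=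
  RawForm.IsSmooth.pastForm hΘ hp hα.1 hα.2

lemma isNegOf_pastOperator :
    IsNegOf (forwardG Θ) (loweringCochain (pastOperator hΘ hp (pastForm_mem_deRham hΘ hp))) := by
  intro p q h x k hk hk' r v
  have hmem := (deRham N).compact.form_mem x (k + 1) hk'
  rw [form_loweringCochain _ p q h x k hk hk']
  exact congrArg Neg.neg (pastForm_apply hΘ hp hmem.1 hmem.2 r v)

lemma isRestriction_pastOperator :
    IsRestriction A (loweringCochain (pastOperator hΘ hp (pastForm_mem_deRham hΘ hp)))
      (loweringCochain (pastOperator hΘ hp hA)) := by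
  refine Cochain.ext _ _ fun p q h => ?_
  rw [Cochain.comp_zero_cochain_v, Cochain.zero_cochain_comp_v, Cochain.ofHom_v, Cochain.ofHom_v]
  rfl

end DeRhamSubcomplex

end Cochains

/-! ### Green's homotopies from proper chiral flows -/

section Main

variable {N : Type u} [TopologicalSpace N]
  [ChartedSpace (EuclideanSpace ℝ (Fin 2)) N] [IsManifold (𝓡 2) ∞ N]
  {S : LorentzStructure N} {dir : NullDirection} {Θ : ℝ × N → N}

/-- The null direction matters only for 1-forms, which must go to zero, and 2-forms, which must go
to eigenforms of *. In higher degrees smoothness is the only condition. -/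
lemma LorentzStructure.IsChiralFlow.pastForm_mem (h : S.IsChiralFlow dir Θ)
    (hp : IsProperFlow Θ) (k : ℕ) (α : RawForm N (k + 1))
    (hα : α ∈ (S.dualComplex dir.sign).compact.carrier (k + 1)) :
    pastForm Θ α ∈ (S.dualComplex dir.sign).carrier k := by
  obtain ⟨hΘ, n, -, hn, hint⟩ := h
  match k, α, hα with
  | 0, α, hα =>
    refine (Submodule.mem_bot ℝ).2 (pastForm_eq_zero_of_generator hΘ hint ?_)
    exact ((S.mem_dualForms_iff hn α).1 hα.1).2
  | 1, α, hα =>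
    exact (S.mem_dualForms_iff hn _).2
      ⟨RawForm.IsSmooth.pastForm hΘ hp hα.1 hα.2, pastForm_generator hΘ hp hint hα.1 hα.2⟩
  | k + 2, α, hα => exact RawForm.IsSmooth.pastForm hΘ hp hα.1 hα.2

variable [T2Space N]

theorem LorentzStructure.IsChiralFlow.exists_greensHomotopy (h : S.IsChiralFlow dir Θ)
    (hp : IsProperFlow Θ) : ∃ Γ G, IsNegOf (forwardG Θ) Γ ∧
      IsRestriction (S.dualComplex dir.sign) Γ G ∧
        IsGreensHomotopy (S.dualComplex dir.sign) (S.J dir) G :=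
  ⟨_, _, DeRhamSubcomplex.isNegOf_pastOperator h.1 hp,
    DeRhamSubcomplex.isRestriction_pastOperator h.1 hp (h.pastForm_mem hp),
    DeRhamSubcomplex.isGreensHomotopy_pastOperator h.1 hp (h.pastForm_mem hp) h.future_subset_J⟩

theorem LorentzStructure.IsChiralFlow.exists_greensHomotopy_backward (h : S.IsChiralFlow dir Θ)
    (hp : IsProperFlow Θ) : ∃ Γ G, IsNegOf (backwardG Θ) Γ ∧
      IsRestriction (S.dualComplex dir.opposite.sign) Γ G ∧
        IsGreensHomotopy (S.dualComplex dir.opposite.sign) (S.J dir.opposite) G := by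
  obtain ⟨Γ, G, h1, h2⟩ := h.reversed.exists_greensHomotopy hp.reversed
  refine ⟨Γ, G, fun p q hpq x k hk hk' r v => ?_, h2⟩
  exact (h1 p q hpq x k hk hk' r v).trans
    (congrArg Neg.neg (forwardG_reversedFlow h.1 _ r v))

end Main

end

theorem mainTheorem10 {N : Type*} [TopologicalSpace N] [T2Space N] [SecondCountableTopology N]
    [ChartedSpace (EuclideanSpace ℝ (Fin 2)) N] [IsManifold (𝓡 2) ∞ N]
    (S : LorentzStructure N) :
    (∀ Θ : ℝ × N → N, S.IsChiralFlow .ne Θ → IsProperFlow Θ →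
      (∃ Γ G, IsNegOf (forwardG Θ) Γ ∧ IsRestriction S.selfDual Γ G ∧
        IsGreensHomotopy S.selfDual (S.J .ne) G) ∧
      (∃ Γ G, IsNegOf (backwardG Θ) Γ ∧ IsRestriction S.selfDual Γ G ∧
        IsGreensHomotopy S.selfDual (S.J .sw) G)) ∧
    (∀ Θ : ℝ × N → N, S.IsChiralFlow .nw Θ → IsProperFlow Θ →
      (∃ Γ G, IsNegOf (forwardG Θ) Γ ∧ IsRestriction S.antiSelfDual Γ G ∧
        IsGreensHomotopy S.antiSelfDual (S.J .nw) G) ∧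
      (∃ Γ G, IsNegOf (backwardG Θ) Γ ∧ IsRestriction S.antiSelfDual Γ G ∧
        IsGreensHomotopy S.antiSelfDual (S.J .se) G)) :=
  -- `NullDirection.sign` agrees on opposite directions, so the forward and backward statements
  -- concern the same complex by unfolding.
  ⟨fun _ h hp => ⟨h.exists_greensHomotopy hp, h.exists_greensHomotopy_backward hp⟩,
    fun _ h hp => ⟨h.exists_greensHomotopy hp, h.exists_greensHomotopy_backward hp⟩⟩
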